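/- There is a universal constant $C>0$ such that the following holds. Let $V$ be a finite-dimensional complex inner product space, decomposed as a direct sum of pairwise orthogonal subspaces $V=\bigoplus_{k=1}^K V_k$ with $d_k=\dim V_k$. Let $\mu$ be the probability measure on the unitary group $U(V)$ that is the law of $U=\bigoplus_{k=1}^K U_k$, where $U_1,\dots,U_K$ are independent and each $U_k$ is distributed according to the normalized Haar measure of the unitary group $U(V_k)$. Then for every unit vector $\psi\in V$, every nonzero Hermitian operator $H=\bigoplus_{k=1}^K H_k$ with $H_k\in\mathcal L(V_k)$, and every $\epsilon\ge 0$, $$\mathrm{Pr}_{U\sim\mu}\Big(\big|\langle\psi|U^\dagger H U|\psi\rangle-\mathbb E_{U'\sim\mu}\langle\psi|U'^\dagger H U'|\psi\rangle\big|\ge\epsilon\Big)\;\le\;\sum_{k=1}^K \exp\!\left(-\frac{C(d_k+1)\epsilon^2}{2\|H\|^2}\right),$$ where $\|H\|$ is the operator norm. -/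

import Mathlib

open MeasureTheory

noncomputable section

/-- A finite-dimensional complex normed space is complete, so that adjoints of its continuous linear
endomorphisms are available. -/
instance finiteDimensionalCompleteSpace {W : Type*} [NormedAddCommGroup W] [NormedSpace ℂ W]
    [FiniteDimensional ℂ W] : CompleteSpace W :=
  FiniteDimensional.complete ℂ W

section

variable (W : Type*) [NormedAddCommGroup W] [InnerProductSpace ℂ W] [FiniteDimensional ℂ W]

/-- The group of unitary operators of a finite-dimensional complex inner product space, with the
topology of the operator norm and its Borel `σ`-algebra. -/
abbrev UnitaryOp : Type _ := unitary (W →L[ℂ] W)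

/-- The group of unitary operators is compact. -/
instance unitaryOpCompactSpace : CompactSpace (UnitaryOp W) := by
  have : ProperSpace (W →L[ℂ] W) := FiniteDimensional.proper ℂ _
  refine (isCompact_iff_compactSpace (X := W →L[ℂ] W)).mp ?_
  refine Metric.isCompact_of_isClosed_isBounded isClosed_unitary ?_
  refine (Metric.isBounded_closedBall (x := (0 : W →L[ℂ] W)) (r := 1)).subset fun u hu => ?_
  rw [mem_closedBall_zero_iff]
  have h1 : ‖star u * u‖ = ‖u‖ * ‖u‖ := CStarRing.norm_star_mul_self
  have h2 : ‖(1 : W →L[ℂ] W)‖ ≤ 1 := ContinuousLinearMap.norm_id_le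
  rw [Unitary.star_mul_self_of_mem hu] at h1
  nlinarith [norm_nonneg u]

/-- The Haar measure on the group of unitary operators, normalized to total mass one. -/
def unitaryHaar : Measure (UnitaryOp W) :=
  Measure.haarMeasure ⊤

instance unitaryHaarIsProbabilityMeasure : IsProbabilityMeasure (unitaryHaar W) :=
  ⟨Measure.haarMeasure_self (K₀ := (⊤ : TopologicalSpace.PositiveCompacts (UnitaryOp W)))⟩

end

section

variable {V : Type*} [NormedAddCommGroup V] [InnerProductSpace ℂ V] [FiniteDimensional ℂ V]
  {ι : Type*} [Fintype ι]

/-- The operator `⨁ k, A k` on `V`: the sum over `k` of the operators `A k` of the subspaces `S k`,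
each one extended by zero to the orthogonal complement of `S k`. -/
def blockOp (S : ι → Submodule ℂ V) (A : ∀ k, S k →L[ℂ] S k) : V →L[ℂ] V :=
  ∑ k, (S k).subtypeL ∘L A k ∘L (S k).orthogonalProjectionOnto

theorem star_blockOp (S : ι → Submodule ℂ V) (A : ∀ k, S k →L[ℂ] S k) :
    star (blockOp S A) = blockOp S fun k => star (A k) := by
  simp only [blockOp, star_sum, ContinuousLinearMap.star_eq_adjoint,
    ContinuousLinearMap.adjoint_comp, Submodule.adjoint_subtypeL,
    Submodule.adjoint_orthogonalProjectionOnto, ContinuousLinearMap.comp_assoc]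

variable [DecidableEq ι]

/-- `S` is a decomposition of `V` as a direct sum of pairwise orthogonal subspaces. -/
structure IsOrthogonalDecomposition (S : ι → Submodule ℂ V) : Prop where
  orthogonal : OrthogonalFamily ℂ (fun k => S k) fun k => (S k).subtypeₗᵢ
  isInternal : DirectSum.IsInternal S

theorem blockOp_apply_mem {S : ι → Submodule ℂ V} (hS : IsOrthogonalDecomposition S)
    (A : ∀ k, S k →L[ℂ] S k) (k : ι) (x : S k) : blockOp S A x = A k x := by
  simp only [blockOp, sum_apply, ContinuousLinearMap.comp_apply,
    Submodule.subtypeL_apply]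
  rw [Finset.sum_eq_single k]
  · simp
  · intro j _ hjk
    have : (S j).orthogonalProjectionOnto (x : V) = 0 := by
      rw [Submodule.orthogonalProjectionOnto_eq_zero_iff]
      exact (hS.orthogonal.isOrtho hjk.symm) x.2
    simp [this]
  · simp

theorem blockOp_mul {S : ι → Submodule ℂ V} (hS : IsOrthogonalDecomposition S)
    (A B : ∀ k, S k →L[ℂ] S k) :
    blockOp S A * blockOp S B = blockOp S fun k => A k * B k := by
  ext x
  simp only [mul_apply_eq_comp]
  conv_lhs => rw [blockOp.eq_1 S B]
  conv_rhs => rw [blockOp]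
  simp [map_sum, blockOp_apply_mem hS]

theorem blockOp_one {S : ι → Submodule ℂ V} (hS : IsOrthogonalDecomposition S) :
    blockOp S (fun _ => 1) = 1 := by
  ext x
  have := hS.orthogonal.sum_projection_of_mem_iSup x (by
    rw [hS.isInternal.submodule_iSup_eq_top]; trivial)
  simpa [blockOp, sum_apply] using this

/-- The unitary operator `⨁ k, U k` on `V`. -/
def blockUnitary {S : ι → Submodule ℂ V} (hS : IsOrthogonalDecomposition S)
    (U : ∀ k, UnitaryOp (S k)) : UnitaryOp V :=
  ⟨blockOp S fun k => (U k : S k →L[ℂ] S k), by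
    rw [Unitary.mem_iff, star_blockOp, blockOp_mul hS, blockOp_mul hS]
    have h1 (k : ι) : star (U k : S k →L[ℂ] S k) * (U k : S k →L[ℂ] S k) = 1 := (U k).2.1
    have h2 (k : ι) : (U k : S k →L[ℂ] S k) * star (U k : S k →L[ℂ] S k) = 1 := (U k).2.2
    simp only [h1, h2, blockOp_one hS, and_self]⟩

theorem measurable_blockUnitary {S : ι → Submodule ℂ V} (hS : IsOrthogonalDecomposition S) :
    Measurable (blockUnitary hS) := by
  have h (k : ι) : SecondCountableTopology (S k →L[ℂ] S k) := by
    have := FiniteDimensional.proper ℂ (S k →L[ℂ] S k)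
    infer_instance
  refine Continuous.measurable (Continuous.subtype_mk ?_ _)
  unfold blockOp
  fun_prop

/-- The law of the random unitary `⨁ k, U k` on `V`, where the `U k` are independent and `U k` is
drawn from the Haar measure of the unitary group of the subspace `S k`. -/
def blockHaar {S : ι → Submodule ℂ V} (hS : IsOrthogonalDecomposition S) :
    Measure (UnitaryOp V) :=
  (Measure.pi fun k => unitaryHaar (S k)).map (blockUnitary hS)

instance blockHaarIsProbabilityMeasure {S : ι → Submodule ℂ V}
    (hS : IsOrthogonalDecomposition S) : IsProbabilityMeasure (blockHaar hS) :=
  Measure.isProbabilityMeasure_map (measurable_blockUnitary hS).aemeasurable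

/-- The expectation value `⟨ψ| U† H U |ψ⟩`. -/
def rotatedExpectation (H : V →L[ℂ] V) (ψ : V) (U : UnitaryOp V) : ℂ :=
  inner ℂ ψ ((star (U : V →L[ℂ] V) * H * (U : V →L[ℂ] V)) ψ)

end

end

/-!
Write `ψ = ∑ ψₖ` with `ψₖ` in the `k`-th block. The centred expectation value is the sum over `k` of
the centred values of `⟨Uₖ ψₖ, Hₖ Uₖ ψₖ⟩`, hence a convex combination, with weights `‖ψₖ‖²`, of
centred expectation values at Haar random unit vectors of the blocks. If it deviates by `ε`, so does
one of those with nonzero weight, and a union bound reduces the claim to a single block of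
dimension `d`. After subtracting the mean and rescaling, the quantity there is
`Y = ∑ aᵢ |⟨bᵢ, U ψ⟩|²` with an orthonormal eigenbasis `b`, `∑ aᵢ = 0` and `|aᵢ| ≤ 1`, and the claim
is `P(|Y| ≥ ε) ≤ exp (-c (d + 1) ε²)`, without a prefactor on the right.

The direction of a Gaussian vector `g` is distributed as `U ψ`
(`lintegral_coordVolume_eq_lintegral_unitaryHaar`). Since `Y ≥ ε` is the scale-invariant event
`∑ (aᵢ - ε) |gᵢ|² ≥ 0`, an exponential Markov inequality with the explicit Gaussian moments gives
`P(|Y| ≥ ε) ≤ 2 exp (-d ε² / 16)` (`unitaryHaar_real_le_abs_diagForm_le_two_mul_exp`). This suffices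
when `d ε²` is large.

For small `d ε²` the factor two has to be removed, and what is needed is a lower bound of the order of
`min (d ε²) 1` for the small ball probability `P(|Y| < ε)`. Let `τ = √(∑ aᵢ²) / d ≤ 1 / √d`. On the
real plane spanned by the images under `U` of an orthonormal pair, the form restricted to the unit
circle is a trigonometric polynomial `α + w cos (2θ - δ)`. Second moments, computed from the symmetries
of Haar measure (`le_integral_diagBilin_sq_sub`), and fourth moments, again from Gaussian ones
(`integral_diagForm_pow_four_le`), show that with probability bounded below this polynomial has a
zero and `w` is at most a multiple of `τ` (`le_unitaryHaar_goodEvent`). Then it is below `ε` in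
absolute value on a proportion of the circle of the order of `min (ε / τ) 1`. As each unit vector of
the plane is itself distributed as `U ψ`, averaging over the circle bounds the small ball probability
from below (`le_unitaryHaar_abs_diagForm_lt`).
-/

open scoped ENNReal

noncomputable section

/-! ### Haar measure on the unitary group -/

section Haar

variable {W : Type*} [NormedAddCommGroup W] [InnerProductSpace ℂ W] [FiniteDimensional ℂ W]

instance unitaryHaarIsHaarMeasure : (unitaryHaar W).IsHaarMeasure := by
  unfold unitaryHaar; infer_instance

/-- Haar measure on the unitary group is also right invariant: a right translate is again a
left-invariant probability measure, and such a measure is unique. -/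
instance unitaryHaarIsMulRightInvariant : (unitaryHaar W).IsMulRightInvariant where
  map_mul_right_eq_self g := by
    have hm : Measurable fun U : UnitaryOp W => U * g := measurable_mul_const g
    have : IsProbabilityMeasure ((unitaryHaar W).map fun U => U * g) :=
      Measure.isProbabilityMeasure_map hm.aemeasurable
    have : ((unitaryHaar W).map fun U => U * g).IsMulLeftInvariant :=
      isMulLeftInvariant_map_mul_right g
    have : ((unitaryHaar W).map fun U => U * g).IsHaarMeasure :=
      Measure.isHaarMeasure_of_isCompact_nonempty_interior _ Set.univ isCompact_univ
        (by simp) (by simp) (by simp)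
    exact Measure.isHaarMeasure_eq_of_isProbabilityMeasure _ _

theorem UnitaryOp.norm_map (U : UnitaryOp W) (v : W) : ‖(U : W →L[ℂ] W) v‖ = ‖v‖ :=
  (Unitary.linearIsometryEquiv U).norm_map v

variable {ι : Type*} [Fintype ι]

/-- Any two orthonormal bases with the same index type are related by a unitary operator. -/
theorem exists_unitaryOp_basis (e f : OrthonormalBasis ι ℂ W) :
    ∃ g : UnitaryOp W, ∀ i, (g : W →L[ℂ] W) (e i) = f i := by
  refine ⟨Unitary.linearIsometryEquiv.symm (e.equiv f (Equiv.refl ι)), fun i => ?_⟩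
  simp

/-- A unit vector is the member of some orthonormal basis with a prescribed index. -/
theorem exists_orthonormalBasis_apply_eq (b : OrthonormalBasis ι ℂ W) (i : ι) {ψ : W}
    (hψ : ‖ψ‖ = 1) : ∃ e : OrthonormalBasis ι ℂ W, e i = ψ := by
  have hv : Orthonormal ℂ (({i} : Set ι).domRestrict fun _ => ψ) := by
    refine ⟨fun _ => hψ, fun x y hxy => (hxy (Subsingleton.elim x y)).elim⟩
  obtain ⟨e, he⟩ := Orthonormal.exists_orthonormalBasis_extension_of_card_eq
    (Module.finrank_eq_card_basis b.toBasis) hv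
  exact ⟨e, he i rfl⟩

/-- The unitary group acts transitively on unit vectors. -/
theorem exists_unitaryOp_apply_eq {ψ φ : W} (hψ : ‖ψ‖ = 1) (hφ : ‖φ‖ = 1) :
    ∃ g : UnitaryOp W, (g : W →L[ℂ] W) ψ = φ := by
  let b := stdOrthonormalBasis ℂ W
  have hd : Module.finrank ℂ W ≠ 0 := by
    intro h
    have := Module.finrank_zero_iff.mp h
    rw [Subsingleton.elim ψ 0, norm_zero] at hψ
    exact zero_ne_one hψ
  let i : Fin (Module.finrank ℂ W) := ⟨0, Nat.pos_of_ne_zero hd⟩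
  obtain ⟨e, he⟩ := exists_orthonormalBasis_apply_eq b i hψ
  obtain ⟨f, hf⟩ := exists_orthonormalBasis_apply_eq b i hφ
  obtain ⟨g, hg⟩ := exists_unitaryOp_basis e f
  exact ⟨g, by rw [← he, hg, hf]⟩

/-- The law of `U φ` for a Haar unitary `U` is the same for all unit vectors `φ`. -/
theorem lintegral_unitaryHaar_apply_eq (F : W → ℝ≥0∞) {ψ φ : W} (hψ : ‖ψ‖ = 1) (hφ : ‖φ‖ = 1) :
    ∫⁻ U, F ((U : W →L[ℂ] W) φ) ∂unitaryHaar W = ∫⁻ U, F ((U : W →L[ℂ] W) ψ) ∂unitaryHaar W := by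
  obtain ⟨g, hg⟩ := exists_unitaryOp_apply_eq hψ hφ
  rw [← lintegral_mul_right_eq_self (μ := unitaryHaar W) (fun U => F ((U : W →L[ℂ] W) ψ)) g]
  simp [hg]

end Haar

/-! ### Lebesgue measure in polar coordinates and Gaussian integrals -/

section Lebesgue

theorem OrthonormalBasis.equivFunL_symm_apply {W : Type*} [NormedAddCommGroup W]
    [InnerProductSpace ℂ W] {ι : Type*} [Fintype ι] (b : OrthonormalBasis ι ℂ W) (z : ι → ℂ) :
    b.toBasis.equivFunL.symm z = ∑ i, z i • b i :=
  (b.toBasis.equivFun_symm_apply z).trans (by simp)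

variable {W : Type*} [NormedAddCommGroup W] [InnerProductSpace ℂ W] [FiniteDimensional ℂ W]
  [MeasurableSpace W] [BorelSpace W] {ι : Type*} [Fintype ι]

/-- Lebesgue measure on `W`, transported from `ι → ℂ` along the coordinates of an orthonormal
basis. -/
def coordVolume (b : OrthonormalBasis ι ℂ W) : Measure W :=
  (volume : Measure (ι → ℂ)).map b.toBasis.equivFunL.symm

instance coordVolumeIsAddHaarMeasure (b : OrthonormalBasis ι ℂ W) : (coordVolume b).IsAddHaarMeasure :=
  ContinuousLinearEquiv.isAddHaarMeasure_map _ _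

/-- Lebesgue measure on a complex inner product space is invariant under unitary operators. -/
theorem map_unitaryOp_coordVolume (b : OrthonormalBasis ι ℂ W) (U : UnitaryOp W) :
    (coordVolume b).map (U : W →L[ℂ] W) = coordVolume b := by
  let _ : InnerProductSpace ℝ W := InnerProductSpace.rclikeToReal ℂ W
  have : FiniteDimensional ℝ W := FiniteDimensional.complexToReal W
  -- `coordVolume b` is a multiple of the volume of the underlying Euclidean space, for which
  -- invariance under isometries is known
  obtain ⟨c, hc⟩ : ∃ c : NNReal, coordVolume b = c • (volume : Measure W) :=
    ⟨_, Measure.isAddLeftInvariant_eq_smul (coordVolume b) volume⟩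
  let T : W ≃ₗᵢ[ℝ] W :=
    { (Unitary.linearIsometryEquiv U).toLinearEquiv.restrictScalars ℝ with
      norm_map' := (Unitary.linearIsometryEquiv U).norm_map }
  have hT : (T : W → W) = (U : W →L[ℂ] W) := rfl
  have := (LinearIsometryEquiv.measurePreserving T).map_eq
  rw [hT] at this
  rw [hc, Measure.map_smul, this]

/-- Integration in polar coordinates, with the direction drawn as `U ψ` for a Haar unitary `U`.
Both sides are compared with the average over `U` of the integral of `F (U v)`. -/
theorem lintegral_coordVolume_eq_lintegral_unitaryHaar (b : OrthonormalBasis ι ℂ W) {ψ : W}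
    (hψ : ‖ψ‖ = 1) {F : W → ℝ≥0∞} (hF : Measurable F) :
    ∫⁻ v, F v ∂coordVolume b
      = ∫⁻ v, ∫⁻ U, F ((‖v‖ : ℂ) • (U : W →L[ℂ] W) ψ) ∂unitaryHaar W ∂coordVolume b := by
  have hmeas : Measurable fun p : UnitaryOp W × W => (p.1 : W →L[ℂ] W) p.2 :=
    Continuous.measurable (by fun_prop)
  have h1 (U : UnitaryOp W) :
      ∫⁻ v, F ((U : W →L[ℂ] W) v) ∂coordVolume b = ∫⁻ v, F v ∂coordVolume b := by
    conv_rhs => rw [← map_unitaryOp_coordVolume b U]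
    rw [lintegral_map hF (U : W →L[ℂ] W).continuous.measurable]
  have h2 : ∫⁻ v, F v ∂coordVolume b
      = ∫⁻ U, ∫⁻ v, F ((U : W →L[ℂ] W) v) ∂coordVolume b ∂unitaryHaar W := by
    simp [h1]
  rw [h2, lintegral_lintegral_swap (f := fun (U : UnitaryOp W) (v : W) => F ((U : W →L[ℂ] W) v))
    (hF.comp hmeas).aemeasurable]
  refine lintegral_congr fun v => ?_
  by_cases hv : v = 0
  · simp [hv]
  have hv' : (‖v‖ : ℂ) ≠ 0 := by simpa using hv
  have hφ : ‖(‖v‖ : ℂ)⁻¹ • v‖ = 1 := by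
    rw [norm_smul, norm_inv, Complex.norm_real, norm_norm, inv_mul_cancel₀ (by simpa using hv)]
  rw [← lintegral_unitaryHaar_apply_eq (fun w => F ((‖v‖ : ℂ) • w)) hψ hφ]
  simp [smul_smul, hv']

theorem integral_exp_neg_mul_norm_sq_complex {c : ℝ} (hc : 0 < c) :
    ∫ z : ℂ, Real.exp (-(c * ‖z‖ ^ 2)) = Real.pi / c := by
  have := GaussianFourier.integral_rexp_neg_mul_sq_norm (V := ℂ) hc
  simpa [Complex.finrank_real_complex] using this

theorem integrable_exp_neg_mul_norm_sq_complex {c : ℝ} (hc : 0 < c) :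
    Integrable fun z : ℂ => Real.exp (-(c * ‖z‖ ^ 2)) := by
  -- otherwise the integral would have the junk value zero
  by_contra h
  have := integral_exp_neg_mul_norm_sq_complex hc
  rw [integral_undef h] at this
  have : 0 < Real.pi / c := by positivity
  linarith

/-- The Gaussian integral of a diagonal quadratic form in an orthonormal basis. -/
theorem lintegral_coordVolume_exp_neg (b : OrthonormalBasis ι ℂ W) {c : ι → ℝ}
    (hc : ∀ i, 0 < c i) :
    ∫⁻ v, ENNReal.ofReal (Real.exp (-∑ i, c i * ‖inner ℂ (b i) v‖ ^ 2)) ∂coordVolume b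
      = ENNReal.ofReal (∏ i, (Real.pi / c i)) := by
  have hcoord (z : ι → ℂ) (i : ι) : inner ℂ (b i) (b.toBasis.equivFunL.symm z) = z i := by
    rw [b.equivFunL_symm_apply, b.orthonormal.inner_right_fintype]
  have hprod (z : ι → ℂ) : Real.exp (-∑ i, c i * ‖inner ℂ (b i) (b.toBasis.equivFunL.symm z)‖ ^ 2)
      = ∏ i, Real.exp (-(c i * ‖z i‖ ^ 2)) := by
    simp_rw [hcoord]
    rw [← Finset.sum_neg_distrib, Real.exp_sum]
  rw [coordVolume, lintegral_map (by fun_prop) b.toBasis.equivFunL.symm.continuous.measurable]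
  simp_rw [hprod]
  rw [← ofReal_integral_eq_lintegral_ofReal, integral_fintype_prod_volume_eq_prod
    (fun i (x : ℂ) => Real.exp (-(c i * ‖x‖ ^ 2)))]
  · simp_rw [integral_exp_neg_mul_norm_sq_complex (hc _)]
  · exact Integrable.fintype_prod fun i => integrable_exp_neg_mul_norm_sq_complex (hc i)
  · exact Filter.Eventually.of_forall fun z => Finset.prod_nonneg fun i _ => (Real.exp_pos _).le

end Lebesgue

/-! ### Diagonal Hermitian forms -/

section QuadraticForm

variable {W : Type*} [NormedAddCommGroup W] [InnerProductSpace ℂ W]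
  {ι : Type*} [Fintype ι]

/-- The Hermitian form `v ↦ ∑ i, a i * |⟨b i, v⟩|²`, diagonal in the orthonormal basis `b`. -/
def diagForm (b : OrthonormalBasis ι ℂ W) (a : ι → ℝ) (v : W) : ℝ :=
  ∑ i, a i * ‖inner ℂ (b i) v‖ ^ 2

variable (b : OrthonormalBasis ι ℂ W) (a : ι → ℝ)

@[fun_prop]
theorem continuous_diagForm : Continuous (diagForm b a) := by
  unfold diagForm; fun_prop

theorem diagForm_smul (r : ℂ) (v : W) : diagForm b a (r • v) = ‖r‖ ^ 2 * diagForm b a v := by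
  simp only [diagForm, inner_smul_right, norm_mul, Finset.mul_sum]
  exact Finset.sum_congr rfl fun i _ => by ring

theorem diagForm_neg (v : W) : diagForm b (fun i => -a i) v = -diagForm b a v := by
  simp [diagForm]

theorem abs_diagForm_le {L : ℝ} (ha : ∀ i, |a i| ≤ L) (v : W) :
    |diagForm b a v| ≤ L * ‖v‖ ^ 2 := by
  rw [← b.sum_sq_norm_inner_right v, Finset.mul_sum]
  refine (Finset.abs_sum_le_sum_abs _ _).trans (Finset.sum_le_sum fun i _ => ?_)
  rw [abs_mul, abs_of_nonneg (sq_nonneg ‖_‖)]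
  exact mul_le_mul_of_nonneg_right (ha i) (sq_nonneg _)

end QuadraticForm

/-! ### Elementary inequalities -/

section ElementaryInequalities

theorem inv_one_sub_le_exp {u : ℝ} (hu : |u| ≤ 1 / 2) : 1 / (1 - u) ≤ Real.exp (u + u ^ 2) := by
  obtain ⟨h1, h2⟩ := abs_le.mp hu
  rw [div_le_iff₀ (by linarith)]
  rcases le_total 0 u with h | h
  · have := Real.quadratic_le_exp_of_nonneg (x := u + u ^ 2) (by positivity)
    have h3 : 1 ≤ (1 + (u + u ^ 2) + (u + u ^ 2) ^ 2 / 2) * (1 - u) := by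
      have h5 : 0 ≤ (1 - u) * (1 + u) ^ 2 / 2 - u := by
        nlinarith [mul_nonneg h (sub_nonneg.mpr h2), mul_nonneg (mul_nonneg h h) (sub_nonneg.mpr h2)]
      nlinarith [mul_nonneg (sq_nonneg u) h5]
    nlinarith
  · have := Real.add_one_le_exp (u + u ^ 2)
    have h4 : 0 ≤ -u * u ^ 2 := mul_nonneg (by linarith) (sq_nonneg u)
    nlinarith

theorem pow_four_le_exp_add_exp_neg (x : ℝ) : x ^ 4 ≤ 24 * (Real.exp x + Real.exp (-x)) := by
  have key {y : ℝ} (hy : 0 ≤ y) : y ^ 4 ≤ 24 * Real.exp y := by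
    have h := Real.pow_div_factorial_le_exp y hy 4
    rw [div_le_iff₀ (by positivity)] at h
    norm_num [Nat.factorial] at h
    linarith
  rcases le_total 0 x with h | h
  · linarith [key h, Real.exp_pos (-x)]
  · have := key (neg_nonneg.mpr h)
    rw [Even.neg_pow (by decide)] at this
    linarith [Real.exp_pos x]

theorem five_div_sixteen_le_pow_four_add {u : ℝ} :
    5 / 16 ≤ u ^ 4 + Real.exp (-u) / 2 := by
  have h1 := Real.add_one_le_exp (-u)
  nlinarith [mul_nonneg (sq_nonneg (u - 1 / 2)) (by nlinarith [sq_nonneg (u + 1 / 2)] :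
    0 ≤ u ^ 2 + u + 3 / 4)]

end ElementaryInequalities

/-! ### Tail and fourth moment of a traceless form -/

section Gaussian

variable {W : Type*} [NormedAddCommGroup W] [InnerProductSpace ℂ W] [FiniteDimensional ℂ W]
  [MeasurableSpace W] [BorelSpace W] {ι : Type*} [Fintype ι]

/-- Exponential moments of a diagonal form against the Gaussian weight `exp (-‖v‖²)`. -/
theorem lintegral_exp_diagForm_sub_norm_sq_le (b : OrthonormalBasis ι ℂ W) {u : ι → ℝ}
    (hu : ∀ i, |u i| ≤ 1 / 2) :
    ∫⁻ v, ENNReal.ofReal (Real.exp (diagForm b u v - ‖v‖ ^ 2)) ∂coordVolume b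
      ≤ ENNReal.ofReal (Real.pi ^ Fintype.card ι * Real.exp (∑ i, (u i + u i ^ 2))) := by
  have hc (i : ι) : 0 < 1 - u i := by linarith [(abs_le.mp (hu i)).2]
  have h1 (v : W) : diagForm b u v - ‖v‖ ^ 2 = -∑ i, (1 - u i) * ‖inner ℂ (b i) v‖ ^ 2 := by
    rw [← b.sum_sq_norm_inner_right v, diagForm, ← Finset.sum_sub_distrib, ← Finset.sum_neg_distrib]
    exact Finset.sum_congr rfl fun i _ => by ring
  simp_rw [h1]
  rw [lintegral_coordVolume_exp_neg b hc]
  refine ENNReal.ofReal_le_ofReal ?_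
  rw [Real.exp_sum, ← Finset.card_univ, ← Finset.prod_const, ← Finset.prod_mul_distrib]
  refine Finset.prod_le_prod (fun i _ => (div_pos Real.pi_pos (hc i)).le) fun i _ => ?_
  rw [div_eq_mul_one_div]
  exact mul_le_mul_of_nonneg_left (inv_one_sub_le_exp (hu i)) Real.pi_pos.le

theorem lintegral_exp_neg_mul_norm_sq (b : OrthonormalBasis ι ℂ W) {c : ℝ} (hc : 0 < c) :
    ∫⁻ v, ENNReal.ofReal (Real.exp (-(c * ‖v‖ ^ 2))) ∂coordVolume b
      = ENNReal.ofReal ((Real.pi / c) ^ Fintype.card ι) := by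
  have := lintegral_coordVolume_exp_neg b (c := fun _ => c) fun _ => hc
  simpa [← Finset.mul_sum, b.sum_sq_norm_inner_right, div_pow] using this

/-- The Gaussian fourth moment of `‖v‖²` is at least of the order of the fourth power of the
dimension. -/
theorem le_lintegral_norm_pow_eight_mul_exp [Nonempty ι] (b : OrthonormalBasis ι ℂ W) :
    ENNReal.ofReal (Real.pi ^ Fintype.card ι * ((Fintype.card ι : ℝ) ^ 4 / 16))
      ≤ ∫⁻ v, ENNReal.ofReal ((‖v‖ ^ 2) ^ 4 * Real.exp (-‖v‖ ^ 2)) ∂coordVolume b := by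
  set d : ℕ := Fintype.card ι with hd
  have hd0 : 0 < d := Fintype.card_pos
  have hd1 : (0 : ℝ) < d := by exact_mod_cast hd0
  set c : ℝ := 1 + 1 / d with hc
  have hc0 : 0 < c := by positivity
  have hcd : 2 ≤ c ^ d := by
    have := one_add_mul_le_pow (a := 1 / (d : ℝ)) (by linarith [one_div_pos.mpr hd1]) d
    rw [mul_one_div_cancel hd1.ne'] at this
    linarith
  -- an elementary lower bound of the fourth power by an exponential, whose integral is explicit
  have hpt (v : W) : (d : ℝ) ^ 4 * (5 / 16) * Real.exp (-(1 * ‖v‖ ^ 2))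
      ≤ (‖v‖ ^ 2) ^ 4 * Real.exp (-‖v‖ ^ 2) + d ^ 4 / 2 * Real.exp (-(c * ‖v‖ ^ 2)) := by
    have h := five_div_sixteen_le_pow_four_add (u := ‖v‖ ^ 2 / d)
    have h2 : Real.exp (-(c * ‖v‖ ^ 2)) = Real.exp (-(‖v‖ ^ 2 / d)) * Real.exp (-‖v‖ ^ 2) := by
      rw [← Real.exp_add]; congr 1; rw [hc]; ring
    have h3 : (‖v‖ ^ 2) ^ 4 = d ^ 4 * (‖v‖ ^ 2 / d) ^ 4 := by field_simp
    rw [h2, h3, one_mul]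
    have := mul_le_mul_of_nonneg_left h (by positivity : 0 ≤ (d : ℝ) ^ 4 * Real.exp (-‖v‖ ^ 2))
    linarith
  have hint := lintegral_mono (μ := coordVolume b) fun v => ENNReal.ofReal_le_ofReal (hpt v)
  simp_rw [ENNReal.ofReal_add (by positivity : 0 ≤ (‖_‖ ^ 2) ^ 4 * Real.exp (-‖_‖ ^ 2))
    (by positivity : 0 ≤ (d : ℝ) ^ 4 / 2 * Real.exp (-(c * ‖_‖ ^ 2))),
    ENNReal.ofReal_mul (by positivity : 0 ≤ (d : ℝ) ^ 4 / 2),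
    ENNReal.ofReal_mul (by positivity : 0 ≤ (d : ℝ) ^ 4 * (5 / 16))] at hint
  rw [lintegral_const_mul' _ _ ENNReal.ofReal_ne_top, lintegral_add_left (by fun_prop),
    lintegral_const_mul' _ _ ENNReal.ofReal_ne_top, lintegral_exp_neg_mul_norm_sq b one_pos,
    lintegral_exp_neg_mul_norm_sq b hc0, ← ENNReal.ofReal_mul (by positivity),
    ← ENNReal.ofReal_mul (by positivity), ← tsub_le_iff_right,
    ← ENNReal.ofReal_sub _ (by positivity)] at hint
  refine le_trans (ENNReal.ofReal_le_ofReal ?_) hint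
  rw [← hd, div_one, div_pow]
  have h4 : Real.pi ^ d / c ^ d ≤ Real.pi ^ d / 2 :=
    div_le_div_of_nonneg_left (by positivity) (by norm_num) hcd
  have := mul_le_mul_of_nonneg_left h4 (by positivity : 0 ≤ (d : ℝ) ^ 4 / 2)
  linarith

/-- Upper tail of a traceless form at a Haar random unit vector. The direction of a Gaussian vector
is such a random unit vector, and the event is invariant under scaling, so its probability is a
Gaussian one, which the exponential Markov inequality bounds. -/
theorem unitaryHaar_le_diagForm_le (b : OrthonormalBasis ι ℂ W) {a : ι → ℝ}
    (ha : ∀ i, |a i| ≤ 1) (hsum : ∑ i, a i = 0) {ψ : W} (hψ : ‖ψ‖ = 1) {ε : ℝ} (hε : 0 ≤ ε) :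
    unitaryHaar W {U | ε ≤ diagForm b a ((U : W →L[ℂ] W) ψ)}
      ≤ ENNReal.ofReal (Real.exp (-(Fintype.card ι * ε ^ 2 / 16))) := by
  -- for `ε > 1` the event is empty, and for `ε ≤ 1` the exponents `u` below are at most `1 / 2`
  rcases lt_or_ge 1 ε with h1 | h1
  · have : {U : UnitaryOp W | ε ≤ diagForm b a ((U : W →L[ℂ] W) ψ)} = ∅ := by
      ext U
      have := (abs_le.mp (abs_diagForm_le b a ha ((U : W →L[ℂ] W) ψ))).2
      rw [UnitaryOp.norm_map, hψ] at this
      simp only [Set.mem_ofPred_eq, Set.mem_empty_iff_false, iff_false, not_le]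
      linarith
    rw [this]; simp
  set S := {U : UnitaryOp W | ε ≤ diagForm b a ((U : W →L[ℂ] W) ψ)} with hS
  have hSm : MeasurableSet S :=
    (isClosed_le continuous_const (by fun_prop)).measurableSet
  set A := {v : W | ε * ‖v‖ ^ 2 ≤ diagForm b a v} with hA
  have hAm : MeasurableSet A := (isClosed_le (by fun_prop) (by fun_prop)).measurableSet
  let F : W → ℝ≥0∞ := A.indicator fun v => ENNReal.ofReal (Real.exp (-(1 * ‖v‖ ^ 2)))
  have hF : Measurable F := Measurable.indicator (by fun_prop) hAm
  -- `ε / 8` is optimal in the Markov inequality, given the bound `u + u²` on the logarithm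
  set u : ι → ℝ := fun i => ε / 8 * (a i - ε) with hu
  have hae (i : ι) : |a i - ε| ≤ 2 := by
    have := abs_le.mp (ha i)
    exact abs_le.mpr ⟨by linarith, by linarith⟩
  have hu2 (i : ι) : |u i| ≤ 1 / 2 := by
    rw [hu, abs_mul, abs_of_nonneg (by positivity)]
    nlinarith [hae i, abs_nonneg (a i - ε)]
  have hFle (v : W) : F v ≤ ENNReal.ofReal (Real.exp (diagForm b u v - ‖v‖ ^ 2)) := by
    by_cases hv : v ∈ A
    · simp only [F, Set.indicator_of_mem hv]
      refine ENNReal.ofReal_le_ofReal (Real.exp_le_exp.mpr ?_)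
      have : diagForm b u v = ε / 8 * (diagForm b a v - ε * ‖v‖ ^ 2) := by
        rw [← b.sum_sq_norm_inner_right v, diagForm, diagForm, Finset.mul_sum,
          ← Finset.sum_sub_distrib, Finset.mul_sum]
        exact Finset.sum_congr rfl fun i _ => by rw [hu]; ring
      rw [this]
      have := mul_nonneg (by positivity : 0 ≤ ε / 8) (sub_nonneg.mpr hv)
      linarith
    · simp [F, hv]
  have hlow : unitaryHaar W S * ENNReal.ofReal (Real.pi ^ Fintype.card ι)
      ≤ ∫⁻ v, F v ∂coordVolume b := by
    rw [lintegral_coordVolume_eq_lintegral_unitaryHaar b hψ hF]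
    have := lintegral_exp_neg_mul_norm_sq b one_pos
    rw [div_one] at this
    rw [← this, ← lintegral_const_mul' _ _ (measure_ne_top _ _)]
    refine lintegral_mono fun v => ?_
    rw [mul_comm, ← lintegral_indicator_const hSm]
    refine lintegral_mono fun U => ?_
    by_cases hU : U ∈ S
    · have hm : (‖v‖ : ℂ) • (U : W →L[ℂ] W) ψ ∈ A := by
        rw [hA, Set.mem_ofPred_eq, diagForm_smul, norm_smul, UnitaryOp.norm_map, hψ, mul_one, mul_comm]
        exact mul_le_mul_of_nonneg_left hU (sq_nonneg _)
      simp only [F, Set.indicator_of_mem hm, Set.indicator_of_mem hU]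
      rw [norm_smul, UnitaryOp.norm_map, hψ]
      simp
    · simp [hU]
  have hup := (hlow.trans (lintegral_mono hFle)).trans (lintegral_exp_diagForm_sub_norm_sq_le b hu2)
  rw [mul_comm, ENNReal.ofReal_mul (by positivity)] at hup
  refine ((ENNReal.mul_le_mul_iff_right (by positivity) ENNReal.ofReal_ne_top).mp hup).trans
    (ENNReal.ofReal_le_ofReal (Real.exp_le_exp.mpr ?_))
  have h5 : ∑ i, u i = -(Fintype.card ι * ε ^ 2 / 8) := by
    rw [hu, ← Finset.mul_sum, Finset.sum_sub_distrib, hsum]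
    simp; ring
  have h6 : ∑ i, u i ^ 2 ≤ Fintype.card ι * (ε ^ 2 / 16) := by
    refine (Finset.sum_le_card_nsmul Finset.univ _ (ε ^ 2 / 16) fun i _ => ?_).trans (by simp)
    have := sq_le_sq' (neg_le_of_abs_le (hae i)) (abs_le.mp (hae i)).2
    rw [hu, mul_pow]
    nlinarith [sq_nonneg (ε / 8)]
  rw [Finset.sum_add_distrib, h5]
  linarith

/-- Fourth moment of a traceless form at a Haar random unit vector, obtained by dividing Gaussian
moments. The scale `√(∑ aᵢ²) / d` is that of the standard deviation. -/
theorem integral_diagForm_pow_four_le [Nonempty ι] (b : OrthonormalBasis ι ℂ W) {a : ι → ℝ}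
    (hsum : ∑ i, a i = 0) (ha : 0 < ∑ i, a i ^ 2) {ψ : W} (hψ : ‖ψ‖ = 1) :
    ∫ U, diagForm b a ((U : W →L[ℂ] W) ψ) ^ 4 ∂unitaryHaar W
      ≤ 40000 * ((∑ i, a i ^ 2) ^ 2 / Fintype.card ι ^ 4) := by
  set p : ℝ := ∑ i, a i ^ 2 with hp
  set d : ℕ := Fintype.card ι with hd
  have hd1 : (0 : ℝ) < d := by exact_mod_cast (Fintype.card_pos : 0 < Fintype.card ι)
  -- the largest scale at which the exponential moment bound applies to all eigenvalues
  set s : ℝ := 1 / (2 * √p) with hs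
  have hsp : s ^ 2 * p = 1 / 4 := by
    rw [hs, div_pow, mul_pow, Real.sq_sqrt ha.le]; field_simp; norm_num
  have hs0 : 0 < s := by rw [hs]; positivity
  have hexp (σ : ℝ) (hσ : σ ^ 2 = 1) :
      ∫⁻ v, ENNReal.ofReal (Real.exp (diagForm b (fun i => σ * s * a i) v - ‖v‖ ^ 2)) ∂coordVolume b
        ≤ ENNReal.ofReal (Real.pi ^ d * 3) := by
    refine (lintegral_exp_diagForm_sub_norm_sq_le b fun i => ?_).trans
      (ENNReal.ofReal_le_ofReal (mul_le_mul_of_nonneg_left ?_ (by positivity)))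
    · refine abs_le_of_sq_le_sq ?_ (by norm_num)
      have : a i ^ 2 ≤ p := Finset.single_le_sum (f := fun i => a i ^ 2)
        (fun j _ => sq_nonneg (a j)) (Finset.mem_univ i)
      rw [mul_pow, mul_pow, hσ]
      nlinarith [sq_nonneg s]
    · rw [Finset.sum_add_distrib, ← Finset.mul_sum, hsum]
      simp_rw [mul_pow]
      rw [← Finset.mul_sum, hσ, one_mul, hsp]
      refine (Real.exp_le_exp.mpr (by norm_num : _ ≤ (1 : ℝ))).trans ?_
      linarith [Real.exp_one_lt_d9]
  have hpt (v : W) : diagForm b a v ^ 4 * Real.exp (-‖v‖ ^ 2)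
      ≤ 384 * p ^ 2 * (Real.exp (diagForm b (fun i => 1 * s * a i) v - ‖v‖ ^ 2)
        + Real.exp (diagForm b (fun i => -1 * s * a i) v - ‖v‖ ^ 2)) := by
    have hl (σ : ℝ) : diagForm b (fun i => σ * s * a i) v = σ * (s * diagForm b a v) := by
      simp only [diagForm, Finset.mul_sum]
      exact Finset.sum_congr rfl fun i _ => by ring
    have h1 := pow_four_le_exp_add_exp_neg (s * diagForm b a v)
    have h2 : 16 * p ^ 2 * (s * diagForm b a v) ^ 4 = diagForm b a v ^ 4 := by
      calc _ = 16 * (s ^ 2 * p) ^ 2 * diagForm b a v ^ 4 := by ring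
        _ = _ := by rw [hsp]; ring
    rw [hl, hl, sub_eq_add_neg, sub_eq_add_neg, Real.exp_add, Real.exp_add, one_mul, neg_one_mul,
      ← h2]
    have := mul_le_mul_of_nonneg_left h1 (by positivity : 0 ≤ 16 * p ^ 2 * Real.exp (-‖v‖ ^ 2))
    linarith
  have hup : ∫⁻ v, ENNReal.ofReal (diagForm b a v ^ 4 * Real.exp (-‖v‖ ^ 2)) ∂coordVolume b
      ≤ ENNReal.ofReal (384 * p ^ 2 * (Real.pi ^ d * 6)) := by
    refine (lintegral_mono fun v => ENNReal.ofReal_le_ofReal (hpt v)).trans ?_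
    simp_rw [ENNReal.ofReal_mul (by positivity : 0 ≤ 384 * p ^ 2),
      ENNReal.ofReal_add (Real.exp_pos _).le (Real.exp_pos _).le]
    rw [lintegral_const_mul' _ _ ENNReal.ofReal_ne_top, lintegral_add_left (by fun_prop)]
    refine mul_le_mul_right ((add_le_add (hexp 1 (by norm_num)) (hexp (-1) (by norm_num))).trans ?_) _
    rw [← ENNReal.ofReal_add (by positivity) (by positivity)]
    exact ENNReal.ofReal_le_ofReal (by linarith)
  have hsplit : ∫⁻ v, ENNReal.ofReal (diagForm b a v ^ 4 * Real.exp (-‖v‖ ^ 2)) ∂coordVolume b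
      = (∫⁻ v, ENNReal.ofReal ((‖v‖ ^ 2) ^ 4 * Real.exp (-‖v‖ ^ 2)) ∂coordVolume b)
        * ∫⁻ U, ENNReal.ofReal (diagForm b a ((U : W →L[ℂ] W) ψ) ^ 4) ∂unitaryHaar W := by
    rw [lintegral_coordVolume_eq_lintegral_unitaryHaar b hψ (by fun_prop),
      ← lintegral_mul_const _ (by fun_prop)]
    refine lintegral_congr fun v => ?_
    rw [← lintegral_const_mul' _ _ ENNReal.ofReal_ne_top]
    refine lintegral_congr fun U => ?_
    rw [← ENNReal.ofReal_mul (by positivity), diagForm_smul, norm_smul, UnitaryOp.norm_map, hψ]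
    congr 1
    simp only [Complex.norm_real, norm_norm, mul_one]
    ring
  have hint : Integrable (fun U : UnitaryOp W => diagForm b a ((U : W →L[ℂ] W) ψ) ^ 4)
      (unitaryHaar W) :=
    (Continuous.integrable_of_hasCompactSupport (by fun_prop) (HasCompactSupport.of_compactSpace _))
  rw [hsplit, ← ofReal_integral_eq_lintegral_ofReal hint
    (Filter.Eventually.of_forall fun U => by positivity)] at hup
  have hfin := (mul_le_mul_left (le_lintegral_norm_pow_eight_mul_exp b) _).trans hup
  rw [← ENNReal.ofReal_mul (by positivity), ENNReal.ofReal_le_ofReal_iff (by positivity), ← hd] at hfin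
  have hpi : 0 < Real.pi ^ d := by positivity
  rw [← mul_div_assoc, le_div_iff₀ (by positivity)]
  have h7 : Real.pi ^ d * ((∫ U, diagForm b a ((U : W →L[ℂ] W) ψ) ^ 4 ∂unitaryHaar W) * d ^ 4)
      ≤ Real.pi ^ d * (40000 * p ^ 2) := by
    nlinarith [mul_nonneg hpi.le (sq_nonneg p)]
  exact le_of_mul_le_mul_left h7 hpi

end Gaussian

/-! ### The real bilinear form of a diagonal form -/

section BilinearForm

variable {W : Type*} [NormedAddCommGroup W] [InnerProductSpace ℂ W]
  {ι : Type*} [Fintype ι]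

/-- The self-adjoint operator with eigenvectors `b i` and eigenvalues `a i`. -/
def diagOp (b : OrthonormalBasis ι ℂ W) (a : ι → ℝ) (v : W) : W :=
  ∑ i, ((a i : ℂ) * inner ℂ (b i) v) • b i

/-- The real bilinear form whose quadratic form is `diagForm b a`. -/
def diagBilin (b : OrthonormalBasis ι ℂ W) (a : ι → ℝ) (x y : W) : ℝ :=
  (inner ℂ x (diagOp b a y)).re

variable (b : OrthonormalBasis ι ℂ W) (a : ι → ℝ)

theorem diagOp_add (x y : W) : diagOp b a (x + y) = diagOp b a x + diagOp b a y := by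
  simp only [diagOp, inner_add_right, mul_add, add_smul, Finset.sum_add_distrib]

theorem diagOp_smul (r : ℂ) (x : W) : diagOp b a (r • x) = r • diagOp b a x := by
  simp only [diagOp, inner_smul_right, Finset.smul_sum, smul_smul]
  exact Finset.sum_congr rfl fun i _ => by ring_nf

theorem norm_diagOp_sq (v : W) : ‖diagOp b a v‖ ^ 2 = diagForm b (fun i => a i ^ 2) v := by
  rw [← b.sum_sq_norm_inner_right, diagForm]
  refine Finset.sum_congr rfl fun i _ => ?_
  rw [diagOp, b.orthonormal.inner_right_fintype, norm_mul, mul_pow, Complex.norm_real,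
    Real.norm_eq_abs, sq_abs]

theorem inner_diagOp_self (v : W) : inner ℂ v (diagOp b a v) = (diagForm b a v : ℂ) := by
  simp only [diagOp, inner_sum, inner_smul_right, diagForm, Complex.ofReal_sum, Complex.ofReal_mul]
  refine Finset.sum_congr rfl fun i _ => ?_
  rw [mul_assoc, ← inner_conj_symm v (b i), Complex.mul_conj, Complex.normSq_eq_norm_sq]

theorem diagBilin_self (v : W) : diagBilin b a v v = diagForm b a v := by
  rw [diagBilin, inner_diagOp_self, Complex.ofReal_re]

theorem diagBilin_comm (x y : W) : diagBilin b a x y = diagBilin b a y x := by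
  simp only [diagBilin, diagOp, inner_sum, inner_smul_right, Complex.re_sum, mul_assoc,
    Complex.re_ofReal_mul]
  refine Finset.sum_congr rfl fun i _ => ?_
  rw [← Complex.conj_re, map_mul, inner_conj_symm, inner_conj_symm, mul_comm (inner ℂ y (b i))]

theorem diagBilin_I_smul (x y : W) :
    diagBilin b a x (Complex.I • y) = -(inner ℂ x (diagOp b a y)).im := by
  simp [diagBilin, diagOp_smul]

theorem diagBilin_I_smul_self (x : W) : diagBilin b a x (Complex.I • x) = 0 := by
  rw [diagBilin_I_smul, inner_diagOp_self, Complex.ofReal_im, neg_zero]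

theorem diagForm_smul_add_smul (c s : ℝ) (x y : W) :
    diagForm b a ((c : ℂ) • x + (s : ℂ) • y)
      = c ^ 2 * diagForm b a x + 2 * c * s * diagBilin b a x y + s ^ 2 * diagForm b a y := by
  have h := diagBilin_comm b a x y
  simp only [← diagBilin_self] at *
  simp only [diagBilin, diagOp_add, diagOp_smul, inner_add_left, inner_add_right, inner_smul_left,
    inner_smul_right, Complex.add_re, Complex.conj_ofReal, Complex.re_ofReal_mul] at *
  rw [← h]; ring

/-- Parseval for the images under the operator, in terms of the real bilinear form. -/
theorem sum_diagBilin_sq (e : OrthonormalBasis ι ℂ W) (x : W) :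
    ∑ j, (diagBilin b a (e j) x ^ 2 + diagBilin b a (e j) (Complex.I • x) ^ 2)
      = diagForm b (fun i => a i ^ 2) x := by
  rw [← norm_diagOp_sq, ← e.sum_sq_norm_inner_right]
  refine Finset.sum_congr rfl fun j _ => ?_
  rw [diagBilin_I_smul, diagBilin, Complex.sq_norm, Complex.normSq_apply]
  ring

theorem sum_diagForm (e : OrthonormalBasis ι ℂ W) : ∑ j, diagForm b a (e j) = ∑ i, a i := by
  simp only [diagForm]
  rw [Finset.sum_comm]
  refine Finset.sum_congr rfl fun i _ => ?_
  rw [← Finset.mul_sum, e.sum_sq_norm_inner_left, b.norm_eq_one]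
  ring

@[fun_prop]
theorem continuous_diagBilin {X : Type*} [TopologicalSpace X] {f g : X → W} (hf : Continuous f)
    (hg : Continuous g) : Continuous fun x => diagBilin b a (f x) (g x) := by
  unfold diagBilin diagOp; fun_prop

end BilinearForm

/-! ### Second moments from the symmetries of Haar measure -/

section Symmetry

variable {W : Type*} [NormedAddCommGroup W] [InnerProductSpace ℂ W] [FiniteDimensional ℂ W]
  {ι : Type*} [Fintype ι]

theorem integrable_unitaryHaar {f : UnitaryOp W → ℝ} (hf : Continuous f) :
    Integrable f (unitaryHaar W) :=
  hf.integrable_of_hasCompactSupport (HasCompactSupport.of_compactSpace f)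

/-- The basis `U e`. -/
def UnitaryOp.mapBasis (U : UnitaryOp W) (e : OrthonormalBasis ι ℂ W) : OrthonormalBasis ι ℂ W :=
  e.map (Unitary.linearIsometryEquiv U)

theorem UnitaryOp.mapBasis_apply (U : UnitaryOp W) (e : OrthonormalBasis ι ℂ W) (i : ι) :
    U.mapBasis e i = (U : W →L[ℂ] W) (e i) := by
  simp only [UnitaryOp.mapBasis, OrthonormalBasis.map_apply]
  rfl

/-- An orthonormal pair extends to an orthonormal basis with prescribed indices. -/
theorem exists_orthonormalBasis_apply_pair (b : OrthonormalBasis ι ℂ W) {i j : ι} (hij : i ≠ j)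
    {x y : W} (hx : ‖x‖ = 1) (hy : ‖y‖ = 1) (hxy : inner ℂ x y = 0) :
    ∃ e : OrthonormalBasis ι ℂ W, e i = x ∧ e j = y := by
  classical
  have hv : Orthonormal ℂ (({i, j} : Set ι).domRestrict fun k => if k = i then x else y) := by
    have hyx : inner ℂ y x = 0 := inner_eq_zero_symm.mp hxy
    constructor
    · rintro ⟨k, hk⟩
      simp only [Set.domRestrict_apply]
      split_ifs <;> assumption
    · rintro ⟨k, hk⟩ ⟨l, hl⟩ hkl
      have hkl' : k ≠ l := fun h => hkl (Subtype.ext h)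
      simp only [Set.domRestrict_apply]
      rcases hk with rfl | rfl <;> rcases hl with rfl | rfl <;>
        simp_all [eq_comm]
  obtain ⟨e, he⟩ := Orthonormal.exists_orthonormalBasis_extension_of_card_eq
    (Module.finrank_eq_card_basis b.toBasis) hv
  exact ⟨e, by simpa using he i (by simp), by simpa [hij.symm] using he j (by simp)⟩

theorem integral_unitaryHaar_apply_eq (Φ : W → ℝ) {x x' : W} (hx : ‖x‖ = 1) (hx' : ‖x'‖ = 1) :
    ∫ U, Φ ((U : W →L[ℂ] W) x) ∂unitaryHaar W = ∫ U, Φ ((U : W →L[ℂ] W) x') ∂unitaryHaar W := by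
  obtain ⟨g, hg⟩ := exists_unitaryOp_apply_eq hx' hx
  rw [← integral_mul_right_eq_self (μ := unitaryHaar W) (fun U => Φ ((U : W →L[ℂ] W) x')) g]
  simp [hg]

/-- The joint law of `(U x, U y)` is the same for all orthonormal pairs `(x, y)`. -/
theorem integral_unitaryHaar_apply_pair_eq (b : OrthonormalBasis ι ℂ W) {i j : ι} (hij : i ≠ j)
    (Φ : W → W → ℝ) {x y x' y' : W}
    (hx : ‖x‖ = 1) (hy : ‖y‖ = 1) (hxy : inner ℂ x y = 0)
    (hx' : ‖x'‖ = 1) (hy' : ‖y'‖ = 1) (hxy' : inner ℂ x' y' = 0) :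
    ∫ U, Φ ((U : W →L[ℂ] W) x) ((U : W →L[ℂ] W) y) ∂unitaryHaar W
      = ∫ U, Φ ((U : W →L[ℂ] W) x') ((U : W →L[ℂ] W) y') ∂unitaryHaar W := by
  obtain ⟨e, rfl, rfl⟩ := exists_orthonormalBasis_apply_pair b hij hx' hy' hxy'
  obtain ⟨f, rfl, rfl⟩ := exists_orthonormalBasis_apply_pair b hij hx hy hxy
  obtain ⟨g, hg⟩ := exists_unitaryOp_basis e f
  rw [← integral_mul_right_eq_self (μ := unitaryHaar W)
    (fun U => Φ ((U : W →L[ℂ] W) (e i)) ((U : W →L[ℂ] W) (e j))) g]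
  simp [hg]

theorem card_mul_integral_diagForm (b : OrthonormalBasis ι ℂ W) (c : ι → ℝ) {ψ : W}
    (hψ : ‖ψ‖ = 1) :
    Fintype.card ι * ∫ U, diagForm b c ((U : W →L[ℂ] W) ψ) ∂unitaryHaar W = ∑ i, c i := by
  have h (j : ι) : ∫ U, diagForm b c ((U : W →L[ℂ] W) ψ) ∂unitaryHaar W
      = ∫ U, diagForm b c ((U : W →L[ℂ] W) (b j)) ∂unitaryHaar W :=
    integral_unitaryHaar_apply_eq _ hψ (b.norm_eq_one j)
  calc _ = ∑ j, ∫ U, diagForm b c ((U : W →L[ℂ] W) (b j)) ∂unitaryHaar W := by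
        simp [← h]
    _ = ∫ U, ∑ j, diagForm b c ((U : W →L[ℂ] W) (b j)) ∂unitaryHaar W :=
        (integral_finsetSum _ fun j _ => integrable_unitaryHaar (by fun_prop)).symm
    _ = _ := by
        simp_rw [← UnitaryOp.mapBasis_apply, sum_diagForm]
        simp

/-- For a traceless form `q` with bilinear form `B` and an orthonormal pair `(x, y)`, the mean of
`B (U x, U y) ^ 2 - q (U x) q (U y)` is bounded below. By symmetry `x` may be replaced by any other
member of an orthonormal basis containing `y`. Summed over that basis, the squares give
`‖A (U y)‖²` by Parseval, up to the imaginary parts, which contribute equally since `y` may be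
replaced by `i y`; the products sum to zero because the trace vanishes. -/
theorem le_integral_diagBilin_sq_sub (b : OrthonormalBasis ι ℂ W) {a : ι → ℝ}
    (hsum : ∑ i, a i = 0) {i₀ i₁ : ι} (hi : i₁ ≠ i₀) :
    (∑ i, a i ^ 2) / Fintype.card ι ^ 2 / 2
      ≤ ∫ U, (diagBilin b a ((U : W →L[ℂ] W) (b i₁)) ((U : W →L[ℂ] W) (b i₀)) ^ 2
          - diagForm b a ((U : W →L[ℂ] W) (b i₁)) * diagForm b a ((U : W →L[ℂ] W) (b i₀)))
          ∂unitaryHaar W := by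
  classical
  set d : ℕ := Fintype.card ι with hd
  have hd1 : 1 < d := Fintype.one_lt_card_iff.mpr ⟨_, _, hi⟩
  have hd1' : (1 : ℝ) < d := by exact_mod_cast hd1
  have hpair {j : ι} (hj : j ≠ i₀) (Φ : W → W → ℝ) :
      ∫ U, Φ ((U : W →L[ℂ] W) (b j)) ((U : W →L[ℂ] W) (b i₀)) ∂unitaryHaar W
        = ∫ U, Φ ((U : W →L[ℂ] W) (b i₁)) ((U : W →L[ℂ] W) (b i₀)) ∂unitaryHaar W :=
    integral_unitaryHaar_apply_pair_eq b hi Φ (b.norm_eq_one _) (b.norm_eq_one _)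
      (b.inner_eq_zero hj) (b.norm_eq_one _) (b.norm_eq_one _) (b.inner_eq_zero hi)
  have hI : ∫ U, diagBilin b a ((U : W →L[ℂ] W) (b i₁)) (Complex.I • (U : W →L[ℂ] W) (b i₀)) ^ 2
        ∂unitaryHaar W
      = ∫ U, diagBilin b a ((U : W →L[ℂ] W) (b i₁)) ((U : W →L[ℂ] W) (b i₀)) ^ 2
        ∂unitaryHaar W := by
    have := integral_unitaryHaar_apply_pair_eq b hi (fun x y => diagBilin b a x y ^ 2)
      (x := b i₁) (y := Complex.I • b i₀) (b.norm_eq_one _)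
      (by rw [norm_smul, b.norm_eq_one]; simp) (by rw [inner_smul_right, b.inner_eq_zero hi, mul_zero])
      (b.norm_eq_one i₁) (b.norm_eq_one i₀) (b.inner_eq_zero hi)
    simpa using this
  -- the moments on the diagonal (`Q`) and off it (`T`, `P`) satisfy the two linear relations
  -- `hsq` and `hprod`
  set Q : ℝ := ∫ U, diagForm b a ((U : W →L[ℂ] W) (b i₀)) ^ 2 ∂unitaryHaar W with hQ
  set T : ℝ := ∫ U, diagBilin b a ((U : W →L[ℂ] W) (b i₁)) ((U : W →L[ℂ] W) (b i₀)) ^ 2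
    ∂unitaryHaar W with hT
  set P : ℝ := ∫ U, diagForm b a ((U : W →L[ℂ] W) (b i₁)) * diagForm b a ((U : W →L[ℂ] W) (b i₀))
    ∂unitaryHaar W with hP
  have hQ0 : 0 ≤ Q := integral_nonneg fun U => sq_nonneg _
  have hcard : ((Finset.univ.erase i₀).card : ℝ) = d - 1 := by
    rw [Finset.card_erase_of_mem (Finset.mem_univ _), Finset.card_univ, ← hd, Nat.cast_sub hd1.le]
    simp
  have hsq : d * (Q + (d - 1) * (2 * T)) = ∑ i, a i ^ 2 := by
    rw [← card_mul_integral_diagForm b (fun i => a i ^ 2) (b.norm_eq_one i₀), ← hd]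
    congr 1
    have hparseval (U : UnitaryOp W) :=
      sum_diagBilin_sq b a (U.mapBasis b) ((U : W →L[ℂ] W) (b i₀))
    simp_rw [UnitaryOp.mapBasis_apply] at hparseval
    simp_rw [← hparseval]
    rw [integral_finsetSum _ fun j _ => integrable_unitaryHaar (by fun_prop),
      ← Finset.add_sum_erase _ _ (Finset.mem_univ i₀)]
    congr 1
    · simp_rw [diagBilin_self, diagBilin_I_smul_self]
      simp [hQ]
    · rw [← hcard, ← nsmul_eq_mul, eq_comm]
      refine Finset.sum_eq_card_nsmul fun j hj => ?_
      have hj := Finset.ne_of_mem_erase hj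
      rw [integral_add (integrable_unitaryHaar (by fun_prop)) (integrable_unitaryHaar (by fun_prop)),
        hpair hj (fun x y => diagBilin b a x y ^ 2),
        hpair hj (fun x y => diagBilin b a x (Complex.I • y) ^ 2), hI, two_mul]
  have hprod : Q + (d - 1) * P = 0 := by
    have h0 : ∫ U, (∑ j, diagForm b a (U.mapBasis b j)) * diagForm b a ((U : W →L[ℂ] W) (b i₀))
        ∂unitaryHaar W = 0 := by
      simp [sum_diagForm, hsum]
    simp_rw [UnitaryOp.mapBasis_apply, Finset.sum_mul] at h0
    rw [integral_finsetSum _ fun j _ => integrable_unitaryHaar (by fun_prop),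
      ← Finset.add_sum_erase _ _ (Finset.mem_univ i₀)] at h0
    rw [← h0]
    congr 1
    · simp [hQ, sq]
    · rw [← hcard, ← nsmul_eq_mul, eq_comm]
      exact Finset.sum_eq_card_nsmul fun j hj =>
        hpair (Finset.ne_of_mem_erase hj) (fun x y => diagForm b a x * diagForm b a y)
  rw [integral_sub (integrable_unitaryHaar (by fun_prop)) (integrable_unitaryHaar (by fun_prop)),
    ← hT, ← hP, div_div, div_le_iff₀ (by positivity), ← hsq]
  have hT0 : 0 ≤ T := integral_nonneg fun U => sq_nonneg _
  have hP0 : P ≤ 0 := by nlinarith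
  nlinarith [mul_nonneg (by linarith : (0 : ℝ) ≤ d) hT0,
    mul_nonneg (by linarith : (0 : ℝ) ≤ d) (neg_nonneg.mpr hP0)]

end Symmetry

/-! ### Trigonometric polynomials of degree one near a zero -/

section Trigonometry

/-- If the range `[α - w, α + w]`, `w = √(β² + γ²)`, of `α + β cos 2θ + γ sin 2θ` contains zero and
`w ≤ R`, then the function stays below `ε` in absolute value on an interval of length of the order
of `ε / R` next to one of its zeros. -/
theorem exists_Ioo_abs_trig_lt {α β γ R ε : ℝ} (h1 : α ^ 2 ≤ β ^ 2 + γ ^ 2)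
    (h2 : β ^ 2 + γ ^ 2 ≤ R ^ 2) (hR : 0 < R) :
    ∃ t, Set.Ioo t (t + min (ε / (2 * R)) 1) ⊆ Set.Icc (-Real.pi) (2 * Real.pi)
      ∩ {θ | |α + β * Real.cos (2 * θ) + γ * Real.sin (2 * θ)| < ε} := by
  set z : ℂ := ⟨β, γ⟩ with hz
  set w : ℝ := ‖z‖ with hw
  have hw2 : w ^ 2 = β ^ 2 + γ ^ 2 := by
    rw [hw, Complex.sq_norm, Complex.normSq_apply]; ring
  have hw0 : 0 ≤ w := norm_nonneg _
  have hwR : w ≤ R := abs_le_of_sq_le_sq' (by linarith) hR.le |>.2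
  have hαw := abs_le_of_sq_le_sq' (h1.trans hw2.ge) hw0
  have hβ : β = w * Real.cos z.arg := (Complex.norm_mul_cos_arg z).symm
  have hγ : γ = w * Real.sin z.arg := (Complex.norm_mul_sin_arg z).symm
  have hf (θ : ℝ) : α + β * Real.cos (2 * θ) + γ * Real.sin (2 * θ)
      = α + w * Real.cos (2 * θ - z.arg) := by
    rw [Real.cos_sub]
    conv_lhs => rw [hβ, hγ]
    ring
  set x : ℝ := Real.arccos (-α / w) with hx
  have hwx : w * Real.cos x = -α := by
    rcases hw0.eq_or_lt with h | h
    · have : α = 0 := by rw [← h] at hαw; linarith [hαw.1, hαw.2]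
      rw [← h, this]; simp
    · rw [hx, Real.cos_arccos, mul_div_cancel₀ _ h.ne']
      · rw [le_div_iff₀ h]; linarith
      · rw [div_le_iff₀ h]; linarith
  refine ⟨(z.arg + x) / 2, fun θ hθ => ⟨⟨?_, ?_⟩, ?_⟩⟩
  · linarith [hθ.1, Complex.neg_pi_lt_arg z, Real.arccos_nonneg (-α / w), Real.pi_pos]
  · linarith [hθ.2, Complex.arg_le_pi z, Real.arccos_le_pi (-α / w), Real.pi_gt_three,
      min_le_right (ε / (2 * R)) 1]
  · rw [Set.mem_ofPred_eq, hf]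
    have h3 : α + w * Real.cos (2 * θ - z.arg) = w * (Real.cos (2 * θ - z.arg) - Real.cos x) := by
      rw [mul_sub, hwx]; ring
    have hlt : 2 * θ - z.arg - x < 2 * (ε / (2 * R)) := by
      linarith [hθ.2, min_le_left (ε / (2 * R)) 1]
    have hpos : 0 < 2 * θ - z.arg - x := by linarith [hθ.1]
    calc _ ≤ w * |2 * θ - z.arg - x| := by
          rw [h3, abs_mul, abs_of_nonneg hw0]
          exact mul_le_mul_of_nonneg_left (Real.abs_cos_sub_cos_le _ _) hw0
      _ ≤ R * (2 * θ - z.arg - x) := by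
          rw [abs_of_pos hpos]; exact mul_le_mul_of_nonneg_right hwR hpos.le
      _ < R * (2 * (ε / (2 * R))) := mul_lt_mul_of_pos_left hlt hR
      _ = ε := by field_simp

end Trigonometry

/-! ### Small ball estimate -/

section SmallBall

theorem norm_smul_add_smul_eq_one {W : Type*} [NormedAddCommGroup W] [InnerProductSpace ℂ W]
    {ι : Type*} [Fintype ι] (b : OrthonormalBasis ι ℂ W) {i j : ι} (hij : i ≠ j) {c s : ℝ}
    (hcs : c ^ 2 + s ^ 2 = 1) : ‖(c : ℂ) • b i + (s : ℂ) • b j‖ = 1 := by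
  have h := norm_add_sq_eq_norm_sq_add_norm_sq_of_inner_eq_zero ((c : ℂ) • b i) ((s : ℂ) • b j)
    (by rw [inner_smul_left, inner_smul_right, b.inner_eq_zero hij]; simp)
  simp only [norm_smul, b.norm_eq_one, Complex.norm_real, Real.norm_eq_abs, mul_one,
    abs_mul_abs_self] at h
  nlinarith [norm_nonneg ((c : ℂ) • b i + (s : ℂ) • b j)]

variable {W : Type*} [NormedAddCommGroup W] [InnerProductSpace ℂ W] [FiniteDimensional ℂ W]
  {ι : Type*} [Fintype ι]

/-- The event that the values of `diagForm b a` on the unit circle of the real plane spanned by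
`U (b i₁)` and `U (b i₀)`, which form an interval, include zero, and that the half-width of this
interval is at most `R`. The first condition compares the squared midpoint with the squared
half-width. -/
def goodEvent (b : OrthonormalBasis ι ℂ W) (a : ι → ℝ) (i₀ i₁ : ι) (R : ℝ) : Set (UnitaryOp W) :=
  {U | ((diagForm b a ((U : W →L[ℂ] W) (b i₁)) + diagForm b a ((U : W →L[ℂ] W) (b i₀))) / 2) ^ 2
      ≤ ((diagForm b a ((U : W →L[ℂ] W) (b i₁)) - diagForm b a ((U : W →L[ℂ] W) (b i₀))) / 2) ^ 2
        + diagBilin b a ((U : W →L[ℂ] W) (b i₁)) ((U : W →L[ℂ] W) (b i₀)) ^ 2} ∩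
  {U | ((diagForm b a ((U : W →L[ℂ] W) (b i₁)) - diagForm b a ((U : W →L[ℂ] W) (b i₀))) / 2) ^ 2
        + diagBilin b a ((U : W →L[ℂ] W) (b i₁)) ((U : W →L[ℂ] W) (b i₀)) ^ 2 ≤ R ^ 2}

theorem measurableSet_goodEvent (b : OrthonormalBasis ι ℂ W) (a : ι → ℝ) (i₀ i₁ : ι) (R : ℝ) :
    MeasurableSet (goodEvent b a i₀ i₁ R) :=
  ((isClosed_le (by fun_prop) (by fun_prop)).inter
    (isClosed_le (by fun_prop) (by fun_prop))).measurableSet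

variable [MeasurableSpace W] [BorelSpace W]

/-- The good event has probability bounded below. Let `Z` be the squared half-width of the interval
of values and `X` the difference of `Z` and the squared midpoint, so that `X ≤ Z`. With
`τ = √(∑ aᵢ²) / d`, the mean of `X` is at least `τ² / 2` and the second moment of `Z` is at most a
multiple of `τ⁴`, so that `X ≥ 0` and `Z ≤ (3000 τ)²` hold together often enough. -/
theorem le_unitaryHaar_goodEvent (b : OrthonormalBasis ι ℂ W) {a : ι → ℝ}
    (hsum : ∑ i, a i = 0) (ha : 0 < ∑ i, a i ^ 2) {i₀ i₁ : ι} (hi : i₁ ≠ i₀) :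
    1 / 36000000 ≤ (unitaryHaar W).real
      (goodEvent b a i₀ i₁ (3000 * (√(∑ i, a i ^ 2) / Fintype.card ι))) := by
  have : Nonempty ι := ⟨i₀⟩
  have hd1 : (0 : ℝ) < Fintype.card ι := by exact_mod_cast (Fintype.card_pos : 0 < Fintype.card ι)
  set τ : ℝ := √(∑ i, a i ^ 2) / Fintype.card ι with hτ
  have hτ0 : 0 < τ := by positivity
  have hτ2 : (∑ i, a i ^ 2) / Fintype.card ι ^ 2 = τ ^ 2 := by
    rw [hτ, div_pow, Real.sq_sqrt ha.le]
  set G := goodEvent b a i₀ i₁ (3000 * τ) with hG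
  have hGm : MeasurableSet G := measurableSet_goodEvent b a i₀ i₁ _
  let q₁ : UnitaryOp W → ℝ := fun U => diagForm b a ((U : W →L[ℂ] W) (b i₁))
  let q₀ : UnitaryOp W → ℝ := fun U => diagForm b a ((U : W →L[ℂ] W) (b i₀))
  let B : UnitaryOp W → ℝ := fun U =>
    diagBilin b a ((U : W →L[ℂ] W) (b i₁)) ((U : W →L[ℂ] W) (b i₀))
  -- by polarization, `B` is a combination of values of the form at unit vectors, so that its fourth
  -- moment is controlled as well
  let r : ℝ := √2 / 2
  have hr : r ^ 2 = 1 / 2 := by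
    simp only [r, div_pow, Real.sq_sqrt (zero_le_two : (0 : ℝ) ≤ 2)]; norm_num
  let φ : W := (r : ℂ) • b i₁ + (r : ℂ) • b i₀
  let q : UnitaryOp W → ℝ := fun U => diagForm b a ((U : W →L[ℂ] W) φ)
  have hφ : ‖φ‖ = 1 := norm_smul_add_smul_eq_one b hi (by linarith)
  have hq₁c : Continuous q₁ := by fun_prop
  have hq₀c : Continuous q₀ := by fun_prop
  have hqc : Continuous q := by fun_prop
  have hBc : Continuous B := by fun_prop
  have hB (U : UnitaryOp W) : B U = q U - (q₁ U + q₀ U) / 2 := by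
    have := diagForm_smul_add_smul b a r r ((U : W →L[ℂ] W) (b i₁)) ((U : W →L[ℂ] W) (b i₀))
    simp only [q, φ, map_add, map_smul, this, B, q₁, q₀]
    linear_combination (-(diagForm b a ((U : W →L[ℂ] W) (b i₁)))
      - diagForm b a ((U : W →L[ℂ] W) (b i₀))
      - 2 * diagBilin b a ((U : W →L[ℂ] W) (b i₁)) ((U : W →L[ℂ] W) (b i₀))) * hr
  let X : UnitaryOp W → ℝ := fun U => B U ^ 2 - q₁ U * q₀ U
  let Z : UnitaryOp W → ℝ := fun U => ((q₁ U - q₀ U) / 2) ^ 2 + B U ^ 2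
  have hXc : Continuous X := by fun_prop
  have hZc : Continuous Z := by fun_prop
  have hZ0 (U : UnitaryOp W) : 0 ≤ Z U := by positivity
  have hXZ (U : UnitaryOp W) : X U ≤ Z U := by
    simp only [X, Z]; nlinarith [sq_nonneg (q₁ U + q₀ U)]
  have hX : τ ^ 2 / 2 ≤ ∫ U, X U ∂unitaryHaar W := by
    rw [← hτ2]; exact le_integral_diagBilin_sq_sub b hsum hi
  have h4 {ψ : W} (hψ : ‖ψ‖ = 1) :
      ∫ U, diagForm b a ((U : W →L[ℂ] W) ψ) ^ 4 ∂unitaryHaar W ≤ 40000 * τ ^ 4 := by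
    refine (integral_diagForm_pow_four_le b hsum ha hψ).trans_eq ?_
    rw [show τ ^ 4 = (τ ^ 2) ^ 2 by ring, ← hτ2]
    ring
  have hZ : ∫ U, Z U ^ 2 ∂unitaryHaar W ≤ 1360000 * τ ^ 4 := by
    have hpt (U : UnitaryOp W) : Z U ^ 2 ≤ 9 * q₁ U ^ 4 + (9 * q₀ U ^ 4 + 16 * q U ^ 4) := by
      have e1 (x y : ℝ) : (x + y) ^ 2 ≤ 2 * x ^ 2 + 2 * y ^ 2 := by nlinarith [sq_nonneg (x - y)]
      have e2 (x y : ℝ) : (x - y) ^ 4 ≤ 8 * x ^ 4 + 8 * y ^ 4 := by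
        nlinarith [sq_nonneg (x + y), sq_nonneg (x ^ 2 - y ^ 2), sq_nonneg ((x + y) ^ 2),
          sq_nonneg (x - y), mul_nonneg (sq_nonneg (x + y)) (sq_nonneg (x - y))]
      have h1 := e1 (((q₁ U - q₀ U) / 2) ^ 2) (B U ^ 2)
      have h2 := e2 (q₁ U) (q₀ U)
      have h3 := e2 (q U) ((q₁ U + q₀ U) / 2)
      have h5 := e2 (q₁ U) (-q₀ U)
      simp only [Z]
      rw [← hB] at h3
      ring_nf at h1 h2 h3 h5 ⊢
      linarith
    have hc (f : UnitaryOp W → ℝ) (hf : Continuous f) (c : ℝ) :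
        Integrable (fun U => c * f U ^ 4) (unitaryHaar W) := integrable_unitaryHaar (by fun_prop)
    refine (integral_mono (integrable_unitaryHaar (by fun_prop))
      (integrable_unitaryHaar (by fun_prop)) hpt).trans ?_
    rw [integral_add (hc _ hq₁c _) (integrable_unitaryHaar (by fun_prop)),
      integral_add (hc _ hq₀c _) (hc _ hqc _), integral_const_mul, integral_const_mul,
      integral_const_mul]
    linarith [h4 (b.norm_eq_one i₁), h4 (b.norm_eq_one i₀), h4 hφ]
  have hpt (U : UnitaryOp W) : X U
      ≤ G.indicator (fun _ => (3000 * τ) ^ 2) U + Z U ^ 2 / (3000 * τ) ^ 2 := by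
    have hR : 0 < (3000 * τ) ^ 2 := by positivity
    by_cases hU : U ∈ G
    · rw [Set.indicator_of_mem hU]
      have h1 := hXZ U
      have h2 : Z U ≤ (3000 * τ) ^ 2 := hU.2
      have : 0 ≤ Z U ^ 2 / (3000 * τ) ^ 2 := by positivity
      linarith
    · rw [Set.indicator_of_notMem hU, zero_add, le_div_iff₀ hR]
      by_cases h2 : Z U ≤ (3000 * τ) ^ 2
      · have h3 : X U ≤ 0 := by
          by_contra h
          refine hU ⟨?_, h2⟩
          simp only [Set.mem_ofPred_eq]
          simp only [X, q₁, q₀, B] at h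
          nlinarith
        nlinarith [sq_nonneg (Z U)]
      · have h2 := (not_le.mp h2).le
        nlinarith [mul_le_mul_of_nonneg_right (hXZ U) hR.le,
          mul_le_mul_of_nonneg_left h2 (hZ0 U)]
  have hint := integral_mono (integrable_unitaryHaar hXc)
    (Integrable.add ((integrable_const ((3000 * τ) ^ 2)).indicator hGm)
      (integrable_unitaryHaar (by fun_prop))) hpt
  rw [Pi.add_def, integral_add ((integrable_const ((3000 * τ) ^ 2)).indicator hGm)
    (integrable_unitaryHaar (by fun_prop)), integral_indicator_const _ hGm, integral_div,
    smul_eq_mul] at hint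
  -- the cutoff `3000 τ` is so large that this error takes away at most half of the mean of `X`
  have h6 : (∫ U, Z U ^ 2 ∂unitaryHaar W) / (3000 * τ) ^ 2 ≤ τ ^ 2 / 4 := by
    rw [div_le_iff₀ (by positivity)]
    nlinarith [pow_pos hτ0 4]
  have h7 : τ ^ 2 * (1 / 4) ≤ τ ^ 2 * (9000000 * (unitaryHaar W).real G) := by nlinarith
  have := le_of_mul_le_mul_left h7 (by positivity)
  linarith

/-- Small ball estimate. Averaging over the rotations of the plane spanned by `b₁` and `b₀`, the
probability is an average over `U` of the proportion of the angles at which the rotated form is below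
`ε` in absolute value; on the good event this is at least a multiple of `min (ε / τ) 1`, with
`τ = √(∑ aᵢ²) / d`. -/
theorem le_unitaryHaar_abs_diagForm_lt (b : OrthonormalBasis ι ℂ W) {a : ι → ℝ}
    (hsum : ∑ i, a i = 0) (ha : 0 < ∑ i, a i ^ 2) {ψ : W} (hψ : ‖ψ‖ = 1) {ε : ℝ} (hε : 0 < ε) :
    min (ε / (6000 * (√(∑ i, a i ^ 2) / Fintype.card ι))) 1 / 432000000
      ≤ (unitaryHaar W).real {U | |diagForm b a ((U : W →L[ℂ] W) ψ)| < ε} := by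
  obtain ⟨i₁, i₀, hi⟩ : ∃ i₁ i₀ : ι, i₁ ≠ i₀ := by
    by_contra! h
    have : Subsingleton ι := ⟨h⟩
    have h0 (i : ι) : a i = 0 := by
      rw [← hsum, Fintype.sum_subsingleton a i]
    simp [h0] at ha
  have : Nonempty ι := ⟨i₀⟩
  have hd1 : (0 : ℝ) < Fintype.card ι := by exact_mod_cast (Fintype.card_pos : 0 < Fintype.card ι)
  set τ : ℝ := √(∑ i, a i ^ 2) / Fintype.card ι with hτ
  have hτ0 : 0 < τ := by positivity
  set G := goodEvent b a i₀ i₁ (3000 * τ) with hG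
  have hP := le_unitaryHaar_goodEvent b hsum ha hi
  rw [← hτ, ← hG] at hP
  let x : ℝ → W := fun θ => (Real.cos θ : ℂ) • b i₁ + (Real.sin θ : ℂ) • b i₀
  have hx (θ : ℝ) : ‖x θ‖ = 1 :=
    norm_smul_add_smul_eq_one b hi (Real.cos_sq_add_sin_sq θ)
  set E : Set (UnitaryOp W × ℝ) :=
    {p | |diagForm b a ((p.1 : W →L[ℂ] W) (x p.2))| < ε} with hE
  have hEm : MeasurableSet E := by
    refine (isOpen_lt ?_ continuous_const).measurableSet
    simp only [x]
    fun_prop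
  set ν : Measure ℝ := volume.restrict (Set.Icc (-Real.pi) (2 * Real.pi)) with hν
  have hangle (U : UnitaryOp W) (hU : U ∈ G) :
      ENNReal.ofReal (min (ε / (6000 * τ)) 1) ≤ ν (Prod.mk U ⁻¹' E) := by
    obtain ⟨t, ht⟩ := exists_Ioo_abs_trig_lt (ε := ε) hU.1 hU.2 (by positivity)
    rw [hν, Measure.restrict_apply (measurable_prodMk_left hEm), Set.inter_comm]
    calc _ = volume (Set.Ioo t (t + min (ε / (2 * (3000 * τ))) 1)) := by
          rw [Real.volume_Ioo, add_sub_cancel_left]; congr 3; ring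
      _ ≤ _ := by
          refine measure_mono (ht.trans (Set.inter_subset_inter_right _ fun θ hθ => ?_))
          simp only [Set.mem_ofPred_eq] at hθ
          simp only [E, x, Set.mem_preimage, Set.mem_ofPred_eq, map_add, map_smul,
            diagForm_smul_add_smul]
          convert hθ using 2
          rw [Real.cos_two_mul', Real.sin_two_mul]
          linear_combination (diagForm b a ((U : W →L[ℂ] W) (b i₁))
            + diagForm b a ((U : W →L[ℂ] W) (b i₀))) / 2 * Real.sin_sq_add_cos_sq θ
  have hfub1 : (unitaryHaar W).prod ν E
      = unitaryHaar W {U | |diagForm b a ((U : W →L[ℂ] W) ψ)| < ε} * ENNReal.ofReal (3 * Real.pi) := by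
    rw [Measure.prod_apply_symm hEm]
    have hθ (θ : ℝ) : unitaryHaar W ((fun U => (U, θ)) ⁻¹' E)
        = unitaryHaar W {U | |diagForm b a ((U : W →L[ℂ] W) ψ)| < ε} := by
      have hS (φ : W) : MeasurableSet {U : UnitaryOp W | |diagForm b a ((U : W →L[ℂ] W) φ)| < ε} :=
        (isOpen_lt (by fun_prop) continuous_const).measurableSet
      have := lintegral_unitaryHaar_apply_eq
        ({v | |diagForm b a v| < ε}.indicator 1) hψ (hx θ)
      rw [← lintegral_indicator_one (hS ψ)]
      exact (lintegral_indicator_one (hS (x θ))).symm.trans this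
    simp_rw [hθ]
    rw [lintegral_const, hν, Measure.restrict_apply_univ, Real.volume_Icc]
    congr 2; ring
  have hfub2 : unitaryHaar W G * ENNReal.ofReal (min (ε / (6000 * τ)) 1)
      ≤ (unitaryHaar W).prod ν E := by
    rw [Measure.prod_apply hEm, mul_comm,
      ← lintegral_indicator_const (measurableSet_goodEvent b a i₀ i₁ _)]
    refine lintegral_mono fun U => ?_
    by_cases hU : U ∈ G
    · rw [Set.indicator_of_mem hU]; exact hangle U hU
    · rw [Set.indicator_of_notMem hU]; exact zero_le
  rw [hfub1] at hfub2
  have hm : 0 ≤ min (ε / (6000 * τ)) 1 := by positivity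
  have hreal := ENNReal.toReal_mono (by finiteness) hfub2
  rw [ENNReal.toReal_mul, ENNReal.toReal_mul, ENNReal.toReal_ofReal hm,
    ENNReal.toReal_ofReal (by positivity)] at hreal
  change (unitaryHaar W).real G * _ ≤ (unitaryHaar W).real _ * _ at hreal
  have h8 := mul_le_mul_of_nonneg_right hP hm
  have h9 : (unitaryHaar W).real {U | |diagForm b a ((U : W →L[ℂ] W) ψ)| < ε} * (3 * Real.pi)
      ≤ (unitaryHaar W).real {U | |diagForm b a ((U : W →L[ℂ] W) ψ)| < ε} * 12 :=
    mul_le_mul_of_nonneg_left (by linarith [Real.pi_lt_four]) measureReal_nonneg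
  linarith

end SmallBall

/-! ### Concentration in one block -/

section Concentration

variable {W : Type*} [NormedAddCommGroup W] [InnerProductSpace ℂ W] [FiniteDimensional ℂ W]
  {ι : Type*} [Fintype ι]

theorem unitaryHaar_real_le_abs_diagForm_le_two_mul_exp (b : OrthonormalBasis ι ℂ W) {a : ι → ℝ}
    (ha : ∀ i, |a i| ≤ 1) (hsum : ∑ i, a i = 0) {ψ : W} (hψ : ‖ψ‖ = 1) {ε : ℝ} (hε : 0 ≤ ε) :
    (unitaryHaar W).real {U | ε ≤ |diagForm b a ((U : W →L[ℂ] W) ψ)|}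
      ≤ 2 * Real.exp (-(Fintype.card ι * ε ^ 2 / 16)) := by
  borelize W
  have h1 := ENNReal.toReal_mono ENNReal.ofReal_ne_top (unitaryHaar_le_diagForm_le b ha hsum hψ hε)
  have h2 := ENNReal.toReal_mono ENNReal.ofReal_ne_top
    (unitaryHaar_le_diagForm_le b (a := fun i => -a i) (by simpa using ha) (by simpa using hsum) hψ hε)
  rw [ENNReal.toReal_ofReal (Real.exp_pos _).le] at h1 h2
  have hsub : {U : UnitaryOp W | ε ≤ |diagForm b a ((U : W →L[ℂ] W) ψ)|}
      ⊆ {U | ε ≤ diagForm b a ((U : W →L[ℂ] W) ψ)}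
        ∪ {U | ε ≤ diagForm b (fun i => -a i) ((U : W →L[ℂ] W) ψ)} := fun U hU => by
    rw [Set.mem_ofPred_eq] at hU
    simp only [diagForm_neg, Set.mem_union, Set.mem_ofPred_eq]
    exact le_abs.mp hU
  have h3 := (measureReal_mono hsub).trans (measureReal_union_le (μ := unitaryHaar W) _ _)
  simp only [measureReal_def] at h3 ⊢
  linarith

/-- Concentration of a traceless form without a prefactor. For `d ε² > 32` half of the exponent of
the Gaussian tail bound absorbs the factor two; for smaller `ε` the small ball estimate applies. -/
theorem unitaryHaar_real_le_abs_diagForm_le (b : OrthonormalBasis ι ℂ W) {a : ι → ℝ}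
    (ha : ∀ i, |a i| ≤ 1) (hsum : ∑ i, a i = 0) {ψ : W} (hψ : ‖ψ‖ = 1) {ε : ℝ} (hε : 0 ≤ ε) :
    (unitaryHaar W).real {U | ε ≤ |diagForm b a ((U : W →L[ℂ] W) ψ)|}
      ≤ Real.exp (-(1 / 10 ^ 15 * (Fintype.card ι + 1) * ε ^ 2)) := by
  borelize W
  have hd : 1 ≤ Fintype.card ι := by
    rw [Nat.one_le_iff_ne_zero]
    intro h0
    have : IsEmpty ι := Fintype.card_eq_zero_iff.mp h0
    have h1 := b.sum_sq_norm_inner_right ψ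
    rw [hψ] at h1
    simp at h1
  have hd' : (1 : ℝ) ≤ Fintype.card ι := by exact_mod_cast hd
  rcases hε.eq_or_lt with rfl | hε
  · simp
  rcases (Finset.sum_nonneg fun i _ => sq_nonneg (a i) : 0 ≤ ∑ i, a i ^ 2).eq_or_lt with hp | hp
  · have h0 (i : ι) : a i = 0 :=
      pow_eq_zero_iff two_ne_zero |>.mp
        ((Finset.sum_eq_zero_iff_of_nonneg fun i _ => sq_nonneg (a i)).mp hp.symm i
          (Finset.mem_univ i))
    have : {U : UnitaryOp W | ε ≤ |diagForm b a ((U : W →L[ℂ] W) ψ)|} = ∅ := by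
      ext U; simp [diagForm, h0, hε]
    rw [this, measureReal_empty]
    exact (Real.exp_pos _).le
  set d : ℝ := (Fintype.card ι : ℝ) with hdd
  set x : ℝ := d * ε ^ 2 with hx
  have hx0 : 0 < x := by positivity
  have hxd : 1 / 10 ^ 15 * (d + 1) * ε ^ 2 ≤ 2 * x / 10 ^ 15 := by
    nlinarith [mul_nonneg (sub_nonneg.mpr hd') (sq_nonneg ε)]
  rcases le_or_gt x 32 with hx32 | hx32
  · have hball := le_unitaryHaar_abs_diagForm_lt b hsum hp hψ hε
    have hm : MeasurableSet {U : UnitaryOp W | |diagForm b a ((U : W →L[ℂ] W) ψ)| < ε} :=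
      (isOpen_lt (by fun_prop) continuous_const).measurableSet
    have hcompl : {U : UnitaryOp W | ε ≤ |diagForm b a ((U : W →L[ℂ] W) ψ)|}
        = {U : UnitaryOp W | |diagForm b a ((U : W →L[ℂ] W) ψ)| < ε}ᶜ := by
      ext U; simp
    rw [hcompl, probReal_compl_eq_one_sub hm]
    have hsq : ∑ i, a i ^ 2 ≤ d := by
      refine (Finset.sum_le_card_nsmul Finset.univ _ 1 fun i _ => ?_).trans (by simp [hdd])
      exact (sq_le_one_iff_abs_le_one _).mpr (ha i)
    have hratio : √x / 6000 ≤ ε / (6000 * (√(∑ i, a i ^ 2) / d)) := by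
      rw [div_le_div_iff₀ (by norm_num) (by positivity), hx, Real.sqrt_mul (by positivity),
        Real.sqrt_sq hε.le]
      have h1 := Real.sqrt_le_sqrt hsq
      have h2 := Real.mul_self_sqrt (by positivity : 0 ≤ d)
      have h3 : √d * (√(∑ i, a i ^ 2) / d) ≤ 1 := by
        rw [← mul_div_assoc, div_le_one (by positivity)]
        nlinarith [Real.sqrt_nonneg d]
      nlinarith
    have hlow : x / 192000 ≤ min (ε / (6000 * (√(∑ i, a i ^ 2) / d))) 1 := by
      refine le_min (le_trans ?_ hratio) (by linarith)
      have h1 := Real.mul_self_sqrt hx0.le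
      have h2 : √x ≤ 32 := by
        rw [Real.sqrt_le_left (by norm_num)]; linarith
      nlinarith [Real.sqrt_nonneg x]
    -- `10 ^ 15` exceeds `2 * 192000 * 432000000`
    have hexp := Real.one_sub_le_exp_neg (1 / 10 ^ 15 * (d + 1) * ε ^ 2)
    linarith
  · refine (unitaryHaar_real_le_abs_diagForm_le_two_mul_exp b ha hsum hψ hε.le).trans ?_
    have h2 : (2 : ℝ) ≤ Real.exp 1 := by linarith [Real.exp_one_gt_d9]
    calc _ ≤ Real.exp 1 * Real.exp (-(x / 16)) :=
          mul_le_mul_of_nonneg_right h2 (Real.exp_pos _).le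
      _ = Real.exp (1 + -(x / 16)) := (Real.exp_add _ _).symm
      _ ≤ _ := Real.exp_le_exp.mpr (by linarith)

/-- Concentration of the expectation value of a self-adjoint operator at a Haar random vector of
prescribed norm. -/
theorem unitaryHaar_real_le_norm_inner_sub_integral_le (T : W →L[ℂ] W) (hT : IsSelfAdjoint T)
    {L : ℝ} (hL : 0 < L) (hTL : ‖T‖ ≤ L) {φ : W} (hφ : φ ≠ 0) {ε : ℝ} (hε : 0 ≤ ε) :
    (unitaryHaar W).real {U | ε * ‖φ‖ ^ 2
        ≤ ‖inner ℂ ((U : W →L[ℂ] W) φ) (T ((U : W →L[ℂ] W) φ))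
          - ∫ U', inner ℂ ((U' : W →L[ℂ] W) φ) (T ((U' : W →L[ℂ] W) φ)) ∂unitaryHaar W‖}
      ≤ Real.exp (-(1 / (2 * 10 ^ 15) * (Module.finrank ℂ W + 1) * ε ^ 2 / (2 * L ^ 2))) := by
  have hsym : (T : W →ₗ[ℂ] W).IsSymmetric := ContinuousLinearMap.isSelfAdjoint_iff_isSymmetric.mp hT
  set d := Module.finrank ℂ W with hd
  obtain ⟨b, l, hTb⟩ : ∃ (b : OrthonormalBasis (Fin d) ℂ W) (l : Fin d → ℝ),
      ∀ i, T (b i) = (l i : ℂ) • b i :=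
    ⟨hsym.eigenvectorBasis rfl, hsym.eigenvalues rfl, hsym.apply_eigenvectorBasis rfl⟩
  have hlL (i : Fin d) : |l i| ≤ L := by
    have h1 := (T.le_opNorm (b i)).trans (mul_le_mul_of_nonneg_right hTL (norm_nonneg _))
    rwa [hTb, norm_smul, b.norm_eq_one, mul_one, mul_one, Complex.norm_real] at h1
  have hTdiag (v : W) : T v = diagOp b l v := by
    conv_lhs => rw [← b.sum_repr' v]
    simp only [map_sum, map_smul, hTb, smul_smul, diagOp]
    exact Finset.sum_congr rfl fun i _ => by rw [mul_comm]
  have hd0 : (0 : ℝ) < d := by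
    have : Nontrivial W := ⟨φ, 0, hφ⟩
    exact_mod_cast Module.finrank_pos
  have hφ0 : 0 < ‖φ‖ := norm_pos_iff.mpr hφ
  set ψ : W := (‖φ‖⁻¹ : ℂ) • φ with hψdef
  have hψ : ‖ψ‖ = 1 := by
    rw [hψdef, norm_smul, norm_inv, Complex.norm_real, norm_norm, inv_mul_cancel₀ hφ0.ne']
  have hφψ : φ = (‖φ‖ : ℂ) • ψ := by
    rw [hψdef, smul_smul, mul_inv_cancel₀ (by exact_mod_cast hφ0.ne'), one_smul]
  -- subtracting the mean eigenvalue makes the form traceless, and dividing by `2 L` brings the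
  -- eigenvalues back into `[-1, 1]`
  set m : ℝ := (∑ i, l i) / d with hm
  have hmL : |m| ≤ L := by
    rw [hm, abs_div, abs_of_pos hd0, div_le_iff₀ hd0]
    refine (Finset.abs_sum_le_sum_abs _ _).trans
      ((Finset.sum_le_card_nsmul Finset.univ _ L fun i _ => hlL i).trans_eq ?_)
    simp [mul_comm]
  set a : Fin d → ℝ := fun i => (l i - m) / (2 * L) with ha
  have ha1 (i : Fin d) : |a i| ≤ 1 := by
    rw [ha, abs_div, abs_of_pos (by positivity : 0 < 2 * L), div_le_one (by positivity)]
    linarith [abs_sub (l i) m, hlL i]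
  have hasum : ∑ i, a i = 0 := by
    rw [ha, ← Finset.sum_div, Finset.sum_sub_distrib]
    simp only [Finset.sum_const, Finset.card_univ, Fintype.card_fin, nsmul_eq_mul, hm]
    field_simp
    simp
  have hform (U : UnitaryOp W) : inner ℂ ((U : W →L[ℂ] W) φ) (T ((U : W →L[ℂ] W) φ))
      = ((‖φ‖ ^ 2 * diagForm b l ((U : W →L[ℂ] W) ψ) : ℝ) : ℂ) := by
    rw [hTdiag, inner_diagOp_self]
    conv_lhs => rw [hφψ, map_smul, diagForm_smul]
    simp
  have hmean : ∫ U, diagForm b l ((U : W →L[ℂ] W) ψ) ∂unitaryHaar W = m := by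
    rw [hm, eq_div_iff hd0.ne', mul_comm, ← card_mul_integral_diagForm b l hψ, Fintype.card_fin]
  have hshift (U : UnitaryOp W) : diagForm b l ((U : W →L[ℂ] W) ψ) - m
      = 2 * L * diagForm b a ((U : W →L[ℂ] W) ψ) := by
    have h1 : m = ∑ i, m * ‖inner ℂ (b i) ((U : W →L[ℂ] W) ψ)‖ ^ 2 := by
      rw [← Finset.mul_sum, b.sum_sq_norm_inner_right, UnitaryOp.norm_map, hψ]; ring
    conv_lhs => rw [h1]
    rw [diagForm, diagForm, ← Finset.sum_sub_distrib, Finset.mul_sum]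
    refine Finset.sum_congr rfl fun i _ => ?_
    rw [ha]; field_simp
  have hset : {U : UnitaryOp W | ε * ‖φ‖ ^ 2
        ≤ ‖inner ℂ ((U : W →L[ℂ] W) φ) (T ((U : W →L[ℂ] W) φ))
          - ∫ U', inner ℂ ((U' : W →L[ℂ] W) φ) (T ((U' : W →L[ℂ] W) φ)) ∂unitaryHaar W‖}
      = {U : UnitaryOp W | ε / (2 * L) ≤ |diagForm b a ((U : W →L[ℂ] W) ψ)|} := by
    ext U
    simp_rw [hform]
    rw [Set.mem_ofPred_eq, Set.mem_ofPred_eq, integral_complex_ofReal, integral_const_mul, hmean,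
      ← Complex.ofReal_sub, Complex.norm_real, ← mul_sub, hshift, Real.norm_eq_abs, abs_mul, abs_mul,
      abs_of_pos (by positivity : 0 < ‖φ‖ ^ 2), abs_of_pos (by positivity : 0 < 2 * L), mul_comm ε,
      mul_le_mul_iff_right₀ (by positivity), div_le_iff₀ (by positivity), mul_comm (2 * L)]
  rw [hset]
  refine (unitaryHaar_real_le_abs_diagForm_le b ha1 hasum hψ (by positivity)).trans_eq ?_
  rw [Fintype.card_fin]
  congr 1
  field_simp

end Concentration

/-! ### Block operators -/

section Blocks

variable {V : Type*} [NormedAddCommGroup V] [InnerProductSpace ℂ V] [FiniteDimensional ℂ V]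
  {ι : Type*} [Fintype ι] [DecidableEq ι] {S : ι → Submodule ℂ V}

theorem isSelfAdjoint_of_blockOp (hS : IsOrthogonalDecomposition S) {h : ∀ k, S k →L[ℂ] S k}
    (hH : IsSelfAdjoint (blockOp S h)) (k : ι) : IsSelfAdjoint (h k) := by
  ext x
  have h1 := star_blockOp S h
  rw [hH.star_eq] at h1
  have h2 := congrArg (fun A : V →L[ℂ] V => A x) h1
  simp only [blockOp_apply_mem hS] at h2
  exact h2.symm

theorem norm_le_norm_blockOp (hS : IsOrthogonalDecomposition S) (h : ∀ k, S k →L[ℂ] S k) (k : ι) :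
    ‖h k‖ ≤ ‖blockOp S h‖ := by
  refine ContinuousLinearMap.opNorm_le_bound _ (norm_nonneg _) fun x => ?_
  have h1 := (blockOp S h).le_opNorm x
  rwa [blockOp_apply_mem hS] at h1

theorem sum_norm_orthogonalProjectionOnto_sq (hS : IsOrthogonalDecomposition S) (ψ : V) :
    ∑ k, ‖(S k).orthogonalProjectionOnto ψ‖ ^ 2 = ‖ψ‖ ^ 2 := by
  have h1 : ψ = ∑ k, (S k).subtypeₗᵢ ((S k).orthogonalProjectionOnto ψ) := by
    conv_lhs => rw [show ψ = (1 : V →L[ℂ] V) ψ from rfl, ← blockOp_one hS]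
    simp [blockOp]
  conv_rhs => rw [h1, hS.orthogonal.norm_sum]

/-- The expectation value of a block operator in the state rotated by a block unitary is the sum of
those of the blocks. -/
theorem rotatedExpectation_blockOp_blockUnitary (hS : IsOrthogonalDecomposition S)
    (h : ∀ k, S k →L[ℂ] S k) (ψ : V) (U : ∀ k, UnitaryOp (S k)) :
    rotatedExpectation (blockOp S h) ψ (blockUnitary hS U)
      = ∑ k, inner ℂ ((U k : S k →L[ℂ] S k) ((S k).orthogonalProjectionOnto ψ))
          (h k ((U k : S k →L[ℂ] S k) ((S k).orthogonalProjectionOnto ψ))) := by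
  have hU : (blockUnitary hS U : V →L[ℂ] V) = blockOp S fun k => (U k : S k →L[ℂ] S k) := rfl
  rw [rotatedExpectation, mul_assoc, mul_apply_eq_comp, ContinuousLinearMap.star_eq_adjoint,
    ContinuousLinearMap.adjoint_inner_right, hU, blockOp_mul hS]
  simp only [blockOp, sum_apply, ContinuousLinearMap.comp_apply, mul_apply_eq_comp]
  exact hS.orthogonal.inner_sum _ _ Finset.univ

theorem continuous_rotatedExpectation (H : V →L[ℂ] V) (ψ : V) :
    Continuous (rotatedExpectation H ψ) := by
  have h (U : UnitaryOp V) : rotatedExpectation H ψ U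
      = inner ℂ ((U : V →L[ℂ] V) ψ) (H ((U : V →L[ℂ] V) ψ)) := by
    rw [rotatedExpectation, mul_assoc, mul_apply_eq_comp, ContinuousLinearMap.star_eq_adjoint,
      ContinuousLinearMap.adjoint_inner_right, mul_apply_eq_comp]
  rw [funext h]
  fun_prop

theorem integral_rotatedExpectation_blockHaar (hS : IsOrthogonalDecomposition S)
    (h : ∀ k, S k →L[ℂ] S k) (ψ : V) :
    ∫ U, rotatedExpectation (blockOp S h) ψ U ∂blockHaar hS
      = ∑ k, ∫ U, inner ℂ ((U : S k →L[ℂ] S k) ((S k).orthogonalProjectionOnto ψ))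
          (h k ((U : S k →L[ℂ] S k) ((S k).orthogonalProjectionOnto ψ))) ∂unitaryHaar (S k) := by
  have hc (k : ι) : Continuous fun U : UnitaryOp (S k) =>
      inner ℂ ((U : S k →L[ℂ] S k) ((S k).orthogonalProjectionOnto ψ))
        (h k ((U : S k →L[ℂ] S k) ((S k).orthogonalProjectionOnto ψ))) := by fun_prop
  have hi (k : ι) := (hc k).integrable_of_hasCompactSupport (μ := unitaryHaar (S k))
    (HasCompactSupport.of_compactSpace _)
  rw [blockHaar, integral_map (measurable_blockUnitary hS).aemeasurable
    (continuous_rotatedExpectation _ ψ).aestronglyMeasurable]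
  simp_rw [rotatedExpectation_blockOp_blockUnitary]
  rw [integral_finsetSum]
  · refine Finset.sum_congr rfl fun k _ => ?_
    exact integral_comp_eval (μ := fun k => unitaryHaar (S k)) (hi k).aestronglyMeasurable
  · exact fun k _ => integrable_comp_eval (μ := fun k => unitaryHaar (S k)) (hi k)

end Blocks

end

/-! ### The union bound over the blocks -/

theorem mainTheorem6 :
    ∃ C : ℝ, 0 < C ∧
      ∀ (V : Type*) [NormedAddCommGroup V] [InnerProductSpace ℂ V] [FiniteDimensional ℂ V]
        (K : ℕ) (S : Fin K → Submodule ℂ V) (hS : IsOrthogonalDecomposition S)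
        (h : ∀ k, S k →L[ℂ] S k) (H : V →L[ℂ] V) (ψ : V) (ε : ℝ),
        H = blockOp S h → IsSelfAdjoint H → H ≠ 0 → ‖ψ‖ = 1 → 0 ≤ ε →
          (blockHaar hS).real
              {U | ε ≤ ‖rotatedExpectation H ψ U
                - ∫ U', rotatedExpectation H ψ U' ∂(blockHaar hS)‖}
            ≤ ∑ k, Real.exp
                (-(C * (Module.finrank ℂ (S k) + 1) * ε ^ 2 / (2 * ‖H‖ ^ 2))) := by
  classical
  refine ⟨1 / (2 * 10 ^ 15), by positivity, ?_⟩
  rintro V _ _ _ K S hS h H ψ ε rfl hH hH0 hψ hε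
  let φ (k : Fin K) : S k := (S k).orthogonalProjectionOnto ψ
  let f (k : Fin K) (U : UnitaryOp (S k)) : ℂ :=
    inner ℂ ((U : S k →L[ℂ] S k) (φ k)) (h k ((U : S k →L[ℂ] S k) (φ k)))
  let E (k : Fin K) : Set (UnitaryOp (S k)) :=
    {U | ε * ‖φ k‖ ^ 2 ≤ ‖f k U - ∫ U', f k U' ∂unitaryHaar (S k)‖}
  have hE (k : Fin K) : MeasurableSet (E k) := by
    refine (isClosed_le continuous_const ?_).measurableSet
    fun_prop
  have hsum : ∑ k, ‖φ k‖ ^ 2 = 1 := by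
    rw [sum_norm_orthogonalProjectionOnto_sq hS, hψ, one_pow]
  have hm : MeasurableSet {U : UnitaryOp V | ε ≤ ‖rotatedExpectation (blockOp S h) ψ U
      - ∫ U', rotatedExpectation (blockOp S h) ψ U' ∂(blockHaar hS)‖} :=
    (isClosed_le continuous_const
      ((continuous_rotatedExpectation _ ψ).sub continuous_const).norm).measurableSet
  rw [measureReal_def, show blockHaar hS _ = _ from Measure.map_apply (measurable_blockUnitary hS) hm,
    ← measureReal_def]
  -- the deviation is a convex combination of the deviations of the blocks with nonzero weight
  have hsub : blockUnitary hS ⁻¹' {U : UnitaryOp V | ε ≤ ‖rotatedExpectation (blockOp S h) ψ U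
      - ∫ U', rotatedExpectation (blockOp S h) ψ U' ∂(blockHaar hS)‖}
      ⊆ ⋃ k ∈ Finset.univ.filter fun k => φ k ≠ 0, Function.eval k ⁻¹' E k := by
    intro U hU
    rw [Set.mem_preimage, Set.mem_ofPred_eq, rotatedExpectation_blockOp_blockUnitary,
      integral_rotatedExpectation_blockHaar, ← Finset.sum_sub_distrib] at hU
    by_contra hcon
    simp only [Set.mem_iUnion, not_exists, Finset.mem_filter, Finset.mem_univ, true_and] at hcon
    have hlt (k : Fin K) (hk : φ k ≠ 0) :
        ‖f k (U k) - ∫ U', f k U' ∂unitaryHaar (S k)‖ < ε * ‖φ k‖ ^ 2 := not_le.mp (hcon k hk)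
    have hle (k : Fin K) : ‖f k (U k) - ∫ U', f k U' ∂unitaryHaar (S k)‖ ≤ ε * ‖φ k‖ ^ 2 := by
      by_cases hk : φ k = 0
      · simp [f, hk]
      · exact (hlt k hk).le
    obtain ⟨k, hk⟩ : ∃ k, φ k ≠ 0 := by
      by_contra! hzero
      simp [hzero] at hsum
    have : ∑ k, ‖f k (U k) - ∫ U', f k U' ∂unitaryHaar (S k)‖ < ∑ k, ε * ‖φ k‖ ^ 2 :=
      Finset.sum_lt_sum (fun k _ => hle k) ⟨k, Finset.mem_univ k, hlt k hk⟩
    rw [← Finset.mul_sum, hsum, mul_one] at this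
    exact absurd (hU.trans (norm_sum_le _ _)) (not_le.mpr this)
  calc _ ≤ ∑ k ∈ Finset.univ.filter fun k => φ k ≠ 0,
        (Measure.pi fun k => unitaryHaar (S k)).real (Function.eval k ⁻¹' E k) :=
        (measureReal_mono hsub (measure_ne_top _ _)).trans (measureReal_biUnion_finset_le _ _)
    _ ≤ ∑ k ∈ Finset.univ.filter fun k => φ k ≠ 0, Real.exp
          (-(1 / (2 * 10 ^ 15) * (Module.finrank ℂ (S k) + 1) * ε ^ 2
            / (2 * ‖blockOp S h‖ ^ 2))) := by
        refine Finset.sum_le_sum fun k hk => ?_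
        rw [measureReal_def, (measurePreserving_eval (fun k => unitaryHaar (S k)) k).measure_preimage
          (hE k).nullMeasurableSet]
        exact unitaryHaar_real_le_norm_inner_sub_integral_le (h k)
          (isSelfAdjoint_of_blockOp hS hH k) (norm_pos_iff.mpr hH0) (norm_le_norm_blockOp hS h k)
          (Finset.mem_filter.mp hk).2 hε
    _ ≤ _ := Finset.sum_le_sum_of_subset_of_nonneg (Finset.filter_subset _ _)
        fun k _ _ => (Real.exp_pos _).le
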